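/- Let $k$ be an algebraically closed field of characteristic zero and let $S\subset k^3$ be a rational ruled surface, i.e. an irreducible algebraic surface such that there is a dominant rational map $k^2\dashrightarrow S$ (a rational parametrization of $S$) and such that through every point of $S$ there passes a line contained in $S$. A rational map $k^2\dashrightarrow k^3$ is in ruled form if it can be written as $\left(\frac{\alpha_i(s)+t\,\beta_i(s)}{\gamma(s)}\right)_{i=1,2,3}$ with polynomials $\alpha_i,\beta_i,\gamma\in k[s]$, $\gamma\neq 0$. The image of a rational map is the set of its values at the points where it is defined. A standardized ruled parametrization of $S$ is given by polynomials $r_i,p_i,q\in k[s]$, $q\ne 0$, such that $$\mathcal P(s,t)=\left(\frac{r_i(s)+t\,p_i(s)}{q(s)}\right)_{i=1,2,3}$$ is a dominant rational map $k^2\dashrightarrow S$, not all $p_i$ are zero, the nonzero $p_i$ have the same degree, and the nonzero $p_i$ have no common root. An affine base point of it is a point $(a,b)\in k^2$ with $q(a)=0$ and $r_i(a)+b\,p_i(a)=0$ for $i=1,2,3$. Then $S$ can be covered by at most two rational parametrizations in ruled form. More precisely: 1. $S$ has a standardized ruled parametrization without affine base points. 2. For every standardized ruled parametrization $\mathcal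 P$ of $S$ without affine base points, either $\operatorname{Image}(\mathcal P)=S$, or there is a line $L\subset S$ with $S\setminus\operatorname{Image}(\mathcal P)\subseteq L$ such that for every index $j$ with $p_j\neq0$, putting $$\mathcal Q(s,t)=\mathcal P\left(s,\frac{q(s)\,t-r_j(s)}{p_j(s)}\right),\qquad \mathcal H(s,t)=\mathcal Q\left(\frac1s,t\right),$$ the map $\mathcal H$ is a rational parametrization of $S$ in ruled form, $\mathcal H$ is defined at $(0,t)$ for all $t\in k$, $t\mapsto\mathcal H(0,t)$ is an affine parametrization $t\mapsto c+t\,v$ ($v\neq0$) of the line $L$, and $S=\operatorname{Image}(\mathcal P)\cup\operatorname{Image}(\mathcal H)$. -/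

import Mathlib

noncomputable section

namespace RuledSurface

/-- The field `k(s,t)` of rational functions in two variables. -/
abbrev FunctionField (k : Type*) [Field k] : Type _ :=
  FractionRing (MvPolynomial (Fin 2) k)

/-- The parameter `s`, as an element of `k(s,t)`. -/
def paramS (k : Type*) [Field k] : FunctionField k :=
  algebraMap (MvPolynomial (Fin 2) k) (FunctionField k) (MvPolynomial.X 0)

/-- The parameter `t`, as an element of `k(s,t)`. -/
def paramT (k : Type*) [Field k] : FunctionField k :=
  algebraMap (MvPolynomial (Fin 2) k) (FunctionField k) (MvPolynomial.X 1)

variable {k : Type*} [Field k]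

/-- The rational map `P : k² ⇢ k³` is defined at `x`, with value `y`: every component of `P` can
be written as a fraction `a / b` of polynomials with `b x ≠ 0`, and `y i = a x / b x`. -/
def HasValueAt (P : Fin 3 → FunctionField k) (x : Fin 2 → k) (y : Fin 3 → k) : Prop :=
  ∀ i, ∃ a b : MvPolynomial (Fin 2) k,
    MvPolynomial.eval x b ≠ 0 ∧
    P i = algebraMap (MvPolynomial (Fin 2) k) (FunctionField k) a /
      algebraMap (MvPolynomial (Fin 2) k) (FunctionField k) b ∧
    y i = MvPolynomial.eval x a / MvPolynomial.eval x b

/-- The set of values of a rational map at the points where it is defined. -/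
def image (P : Fin 3 → FunctionField k) : Set (Fin 3 → k) :=
  {y | ∃ x : Fin 2 → k, HasValueAt P x y}

/-- Zariski closure of a subset of affine 3-space. -/
def zariskiClosure (A : Set (Fin 3 → k)) : Set (Fin 3 → k) :=
  MvPolynomial.zeroLocus k (MvPolynomial.vanishingIdeal k A)

/-- `P` is a rational parametrization of `S`, i.e. a dominant rational map `k² ⇢ S`. -/
def Parametrizes (P : Fin 3 → FunctionField k) (S : Set (Fin 3 → k)) : Prop :=
  zariskiClosure (image P) = S

/-- Irreducible algebraic surface in affine 3-space. -/
def IsSurface (S : Set (Fin 3 → k)) : Prop :=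
  ∃ F : MvPolynomial (Fin 3) k, Irreducible F ∧ S = {x | MvPolynomial.eval x F = 0}

/-- Affine line in 3-space. -/
def IsLine (L : Set (Fin 3 → k)) : Prop :=
  ∃ c v : Fin 3 → k, v ≠ 0 ∧ L = Set.range (fun τ : k => c + τ • v)

/-- Rational ruled surface: an irreducible surface which admits a rational parametrization and
which contains, through each of its points, a line. -/
structure IsRationalRuledSurface (S : Set (Fin 3 → k)) : Prop where
  surface : IsSurface S
  rational : ∃ P : Fin 3 → FunctionField k, Parametrizes P S
  ruled : ∀ x ∈ S, ∃ L : Set (Fin 3 → k), IsLine L ∧ x ∈ L ∧ L ⊆ S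

variable (k) in
/-- Polynomials `rᵢ, pᵢ, q` in one variable, with `q ≠ 0`; they stand for the triple
`((rᵢ(s) + t pᵢ(s)) / q(s))`. -/
structure RuledForm where
  r : Fin 3 → Polynomial k
  p : Fin 3 → Polynomial k
  q : Polynomial k
  q_ne_zero : q ≠ 0

namespace RuledForm

/-- Substitution: the triple `((rᵢ(σ) + τ pᵢ(σ)) / q(σ))` for `σ, τ ∈ k(s,t)`. -/
def subst (D : RuledForm k) (σ τ : FunctionField k) : Fin 3 → FunctionField k :=
  fun i => (Polynomial.aeval σ (D.r i) + τ * Polynomial.aeval σ (D.p i)) / Polynomial.aeval σ D.q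

/-- The rational map `𝒫(s,t) = ((rᵢ(s) + t pᵢ(s)) / q(s))`. -/
def toMap (D : RuledForm k) : Fin 3 → FunctionField k :=
  D.subst (paramS k) (paramT k)

/-- `𝒬(σ,τ) = 𝒫(σ, (q(σ) τ - r_j(σ)) / p_j(σ))`, for an index `j` with `p_j ≠ 0`. -/
def substQ (D : RuledForm k) (j : Fin 3) (σ τ : FunctionField k) : Fin 3 → FunctionField k :=
  D.subst σ
    ((Polynomial.aeval σ D.q * τ - Polynomial.aeval σ (D.r j)) / Polynomial.aeval σ (D.p j))

/-- `ℋ(s,t) = 𝒬(1/s, t)`. -/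
def mapH (D : RuledForm k) (j : Fin 3) : Fin 3 → FunctionField k :=
  D.substQ j (1 / paramS k) (paramT k)

/-- Standardized ruled parametrization of `S`: it is dominant onto `S`, the nonzero `pᵢ` have the
same degree, and the `pᵢ` have no common root (in particular they are not all zero). -/
structure IsStandardized (D : RuledForm k) (S : Set (Fin 3 → k)) : Prop where
  parametrizes : Parametrizes D.toMap S
  degree_eq : ∀ i j, D.p i ≠ 0 → D.p j ≠ 0 → (D.p i).natDegree = (D.p j).natDegree
  exists_ne_zero : ∃ i, D.p i ≠ 0
  no_common_root : ¬ ∃ a : k, ∀ i, D.p i ≠ 0 → (D.p i).eval a = 0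

/-- Affine base point: a common zero of the three numerators and of the denominator. -/
def IsAffineBasePoint (D : RuledForm k) (a b : k) : Prop :=
  D.q.eval a = 0 ∧ ∀ i, (D.r i).eval a + b * (D.p i).eval a = 0

end RuledForm

/-- A rational map is in ruled form if it is `((αᵢ(s) + t βᵢ(s)) / γ(s))` for some polynomials. -/
def IsInRuledForm (P : Fin 3 → FunctionField k) : Prop :=
  ∃ D : RuledForm k, P = D.toMap

end RuledSurface

end

/-!
Let `F = 0` be the equation of `S`. A line of `S` through a point `x` is tangent to `S` at `x`, so
it belongs to a pencil of directions, and for general `x` its slope in this pencil is a common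
root of polynomials with coefficients in the function field of `S`. Such a system either has a
rational root or has two distinct roots at the general point.

* A rational root gives a polynomial vector field whose direction at a general point is that of a
  line of `S`. Restricting it to the image of a line of the parameter plane that is not contained
  in a ruling line sweeps out `S` in ruled form.
* If two lines pass through the general point, fix one line with direction `w`. At its points the
  direction of the second line is tangent to `S` and isotropic for the Hessian of `F`. Since `w`
  is isotropic as well, the equation for the second direction is linear, so this direction is a
  rational function along the first line and again sweeps out `S` in ruled form. The only
  exception is a constant tangent plane along each line, in which case `S` is a plane.

Once `S` has a ruled form, divide the `pᵢ` by their common divisor and equalize their degrees by a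
Möbius transformation of `s`. Substituting `t = b + (s - a) t'` at an affine base point `(a, b)`
cancels a factor `s - a` and lowers the degree of `q`, so finitely many steps remove all base
points.

The point `x` lies on the line with parameter `s` exactly when it satisfies the equations
`xᵢ q pⱼ - xⱼ q pᵢ = rᵢ pⱼ - rⱼ pᵢ` (incidence with a line in Plücker coordinates). These have a
common root `s` for general `x ∈ S`, so by elimination theory, for every `x ∈ S` they have a
common root `s` or all their top coefficients vanish at `x`. In the absence of base points the
first case puts `x` in the image of `𝒫`. The second case either never occurs or describes the line
with parameter `s = ∞`, which is `t ↦ ℋ(0, t)`.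
-/

noncomputable section

namespace RuledSurface

section Values

open MvPolynomial

variable {k : Type*} [Field k]

/-- The germs at `z` together with their values: the pairs `(f, c)` such that the rational function
`f` is defined at `z` and takes the value `c` there. -/
def valueSubalgebra (z : Fin 2 → k) : Subalgebra k (FunctionField k × k) where
  carrier := {x | ∃ a b : MvPolynomial (Fin 2) k, eval z b ≠ 0 ∧
    x.1 = algebraMap _ (FunctionField k) a / algebraMap _ (FunctionField k) b ∧
    x.2 = eval z a / eval z b}
  mul_mem' := by
    rintro _ _ ⟨a, b, hb, h₁, h₂⟩ ⟨c, d, hd, h₃, h₄⟩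
    refine ⟨a * c, b * d, by simp [hb, hd], ?_, ?_⟩
    · simp [h₁, h₃, div_mul_div_comm]
    · simp [h₂, h₄, div_mul_div_comm]
  add_mem' := by
    rintro _ _ ⟨a, b, hb, h₁, h₂⟩ ⟨c, d, hd, h₃, h₄⟩
    have hb' : b ≠ 0 := fun h => hb (by simp [h])
    have hd' : d ≠ 0 := fun h => hd (by simp [h])
    refine ⟨a * d + b * c, b * d, by simp [hb, hd], ?_, ?_⟩
    · simp [h₁, h₃, div_add_div, hb', hd']
    · simp [h₂, h₄, div_add_div, hb, hd]
  algebraMap_mem' c :=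
    ⟨C c, 1, by simp, by simp [← algebraMap_eq,
      IsScalarTower.algebraMap_apply k (MvPolynomial (Fin 2) k) (FunctionField k)], by simp⟩

theorem hasValueAt_iff {P : Fin 3 → FunctionField k} {z : Fin 2 → k} {y : Fin 3 → k} :
    HasValueAt P z y ↔ ∀ i, (P i, y i) ∈ valueSubalgebra z :=
  Iff.rfl

theorem mk_algebraMap_mem_valueSubalgebra (z : Fin 2 → k) (a : MvPolynomial (Fin 2) k) :
    (algebraMap _ (FunctionField k) a, eval z a) ∈ valueSubalgebra z :=
  ⟨a, 1, by simp, by simp, by simp⟩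

theorem eq_zero_of_mem_valueSubalgebra {z : Fin 2 → k} {c : k}
    (h : ((0 : FunctionField k), c) ∈ valueSubalgebra z) : c = 0 := by
  obtain ⟨a, b, hb, h₁, h₂⟩ := h
  have hb' : b ≠ 0 := fun h => hb (by simp [h])
  have ha : a = 0 := by simpa [hb'] using h₁.symm
  simpa [ha] using h₂

theorem mk_div_mem_valueSubalgebra {z : Fin 2 → k} {f g : FunctionField k} {c d : k}
    (hf : (f, c) ∈ valueSubalgebra z) (hg : (g, d) ∈ valueSubalgebra z) (hd : d ≠ 0) :
    (f / g, c / d) ∈ valueSubalgebra z := by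
  have hinv : (g⁻¹, d⁻¹) ∈ valueSubalgebra z := by
    obtain ⟨a, b, _, h₁, h₂⟩ := hg
    have ha : eval z a ≠ 0 := fun ha => hd (by simpa [ha] using h₂)
    exact ⟨b, a, ha, by simpa using congrArg (·⁻¹) h₁, by simpa using congrArg (·⁻¹) h₂⟩
  simpa [div_eq_mul_inv] using mul_mem hf hinv

theorem mk_aeval_mem_valueSubalgebra {z : Fin 2 → k} {f : FunctionField k} {c : k}
    (h : (f, c) ∈ valueSubalgebra z) (G : Polynomial k) :
    (Polynomial.aeval f G, G.eval c) ∈ valueSubalgebra z := by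
  have hG : Polynomial.aeval (f, c) G ∈ valueSubalgebra z :=
    Algebra.adjoin_le (Set.singleton_subset_iff.2 h) (Polynomial.aeval_mem_adjoin_singleton k _)
  rwa [Polynomial.aeval_prod_apply, Polynomial.coe_aeval_eq_eval] at hG

theorem HasValueAt.mk_aeval_mem_valueSubalgebra {P : Fin 3 → FunctionField k} {z : Fin 2 → k}
    {y : Fin 3 → k} (h : HasValueAt P z y) (G : MvPolynomial (Fin 3) k) :
    (aeval P G, eval y G) ∈ valueSubalgebra z := by
  have hmem : aeval (fun i => (P i, y i)) G ∈ valueSubalgebra z := by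
    have hG := (aeval (fun i => (⟨(P i, y i), h i⟩ : valueSubalgebra z)) G).2
    rwa [← Subalgebra.coe_val, comp_aeval_apply] at hG
  have heq : aeval (fun i => (P i, y i)) G = (aeval P G, eval y G) :=
    Prod.ext (comp_aeval_apply _ (AlgHom.fst k (FunctionField k) k) G)
      ((comp_aeval_apply _ (AlgHom.snd k (FunctionField k) k) G).trans
        (by rw [← aeval_eq_eval]; rfl))
  exact heq ▸ hmem

theorem HasValueAt.eval_eq_zero {P : Fin 3 → FunctionField k} {z : Fin 2 → k}
    {y : Fin 3 → k} (h : HasValueAt P z y) {G : MvPolynomial (Fin 3) k} (hG : aeval P G = 0) :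
    eval y G = 0 :=
  eq_zero_of_mem_valueSubalgebra (hG ▸ h.mk_aeval_mem_valueSubalgebra G)

theorem exists_common_denominator (P : Fin 3 → FunctionField k) :
    ∃ (a : Fin 3 → MvPolynomial (Fin 2) k) (b : MvPolynomial (Fin 2) k), b ≠ 0 ∧
      ∀ i, P i = algebraMap _ (FunctionField k) (a i) / algebraMap _ (FunctionField k) b := by
  obtain ⟨b, hb⟩ := IsLocalization.exist_integer_multiples_of_finite
    (nonZeroDivisors (MvPolynomial (Fin 2) k)) P
  choose a ha using hb
  refine ⟨a, b, nonZeroDivisors.coe_ne_zero b, fun i => ?_⟩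
  have hb' : algebraMap _ (FunctionField k) (b : MvPolynomial (Fin 2) k) ≠ 0 := by simp
  rw [eq_div_iff hb', ha i, Algebra.smul_def, mul_comm]

theorem aeval_eq_zero_of_forall_hasValueAt [Infinite k] {P : Fin 3 → FunctionField k}
    {G : MvPolynomial (Fin 3) k} {h : MvPolynomial (Fin 2) k} (hh : h ≠ 0)
    (hG : ∀ z y, eval z h ≠ 0 → HasValueAt P z y → eval y G = 0) : aeval P G = 0 := by
  obtain ⟨a, b, hb, hP⟩ := exists_common_denominator P
  obtain ⟨c, d, hd, hcd⟩ := IsFractionRing.div_surjective (A := MvPolynomial (Fin 2) k) (aeval P G)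
  have hd : d ≠ 0 := nonZeroDivisors.ne_zero hd
  have hc : c * (d * b * h) = 0 := by
    refine MvPolynomial.funext fun z => ?_
    by_contra hz
    simp only [map_mul, map_zero, mul_eq_zero, not_or] at hz
    obtain ⟨hcz, ⟨hdz, hbz⟩, hhz⟩ := hz
    have hvalue : HasValueAt P z (fun i => eval z (a i) / eval z b) :=
      fun i => ⟨a i, b, hbz, hP i, rfl⟩
    have hdiff := sub_mem (mk_div_mem_valueSubalgebra (mk_algebraMap_mem_valueSubalgebra z c)
      (mk_algebraMap_mem_valueSubalgebra z d) hdz) (hvalue.mk_aeval_mem_valueSubalgebra G)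
    rw [hG z _ hhz hvalue, Prod.mk_sub_mk, hcd, sub_self, sub_zero] at hdiff
    exact div_ne_zero hcz hdz (eq_zero_of_mem_valueSubalgebra hdiff)
  have hc : c = 0 := by simpa [hd, hb, hh] using hc
  rw [← hcd, hc, map_zero, zero_div]

theorem vanishingIdeal_image [Infinite k] (P : Fin 3 → FunctionField k) :
    vanishingIdeal k (image P) = RingHom.ker (aeval (R := k) P) := by
  ext G
  simp only [mem_vanishingIdeal_iff, aeval_eq_eval, RingHom.mem_ker]
  constructor
  · exact fun hG => aeval_eq_zero_of_forall_hasValueAt one_ne_zero fun z y _ hy => hG y ⟨z, hy⟩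
  · rintro hG y ⟨z, hy⟩
    exact hy.eval_eq_zero hG

theorem parametrizes_iff_zeroLocus_ker [Infinite k] {P : Fin 3 → FunctionField k}
    {S : Set (Fin 3 → k)} :
    Parametrizes P S ↔ zeroLocus k (RingHom.ker (aeval (R := k) P)) = S := by
  rw [Parametrizes, zariskiClosure, vanishingIdeal_image]

theorem Parametrizes.map [Infinite k] {P : Fin 3 → FunctionField k} {S : Set (Fin 3 → k)}
    (h : Parametrizes P S) (φ : FunctionField k →ₐ[k] FunctionField k) :
    Parametrizes (φ ∘ P) S := by
  rw [parametrizes_iff_zeroLocus_ker] at h ⊢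
  convert h using 2
  ext G
  rw [RingHom.mem_ker, RingHom.mem_ker, Function.comp_def, ← comp_aeval_apply,
    map_eq_zero_iff φ φ.injective]

theorem Parametrizes.image_subset {P : Fin 3 → FunctionField k} {S : Set (Fin 3 → k)}
    (h : Parametrizes P S) : image P ⊆ S :=
  (zeroLocus_vanishingIdeal_le _).trans_eq h

theorem vanishingIdeal_setOf_eval_eq_zero [IsAlgClosed k] {σ : Type*} [Finite σ]
    {F : MvPolynomial σ k} (hF : Irreducible F) :
    vanishingIdeal k {x | eval x F = 0} = Ideal.span {F} := by
  have : (Ideal.span {F}).IsPrime := (Ideal.span_singleton_prime hF.ne_zero).2 hF.prime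
  rw [← IsPrime.vanishingIdeal_zeroLocus (K := k) (Ideal.span {F}), zeroLocus_span]
  simp [aeval_eq_eval]

theorem dvd_iff_forall_eval_eq_zero [IsAlgClosed k] {σ : Type*} [Finite σ]
    {F G : MvPolynomial σ k} (hF : Irreducible F) :
    F ∣ G ↔ ∀ x, eval x F = 0 → eval x G = 0 := by
  rw [← Ideal.mem_span_singleton, ← vanishingIdeal_setOf_eval_eq_zero hF, mem_vanishingIdeal_iff]
  simp [aeval_eq_eval]

theorem parametrizes_iff_ker_eq_span [IsAlgClosed k] {F : MvPolynomial (Fin 3) k}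
    (hF : Irreducible F) {P : Fin 3 → FunctionField k} :
    Parametrizes P {x | eval x F = 0} ↔ RingHom.ker (aeval (R := k) P) = Ideal.span {F} := by
  have hprime := RingHom.ker_isPrime (aeval (R := k) P)
  rw [parametrizes_iff_zeroLocus_ker]
  constructor
  · intro h
    rw [← vanishingIdeal_setOf_eval_eq_zero hF, ← h, IsPrime.vanishingIdeal_zeroLocus]
  · intro h
    rw [h, zeroLocus_span]
    simp [aeval_eq_eval]

end Values

section Substitution

open MvPolynomial
open scoped IntermediateField.algebraAdjoinAdjoin

variable {k : Type*} [Field k]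

theorem exists_algHom_of_adjoin_eq_top {ι : Type*} [Finite ι]
    {x : ι → FractionRing (MvPolynomial ι k)} (hx : IntermediateField.adjoin k (Set.range x) = ⊤) :
    ∃ φ : FractionRing (MvPolynomial ι k) →ₐ[k] FractionRing (MvPolynomial ι k),
      ∀ i, φ (algebraMap (MvPolynomial ι k) _ (X i)) = x i := by
  have halg : Algebra.IsAlgebraic (Algebra.adjoin k (Set.range x))
      (FractionRing (MvPolynomial ι k)) := by
    refine ⟨fun y => (IsFractionRing.isAlgebraic_iff _
      (IntermediateField.adjoin k (Set.range x)) _).2 ?_⟩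
    exact isAlgebraic_algebraMap (⟨y, hx ▸ IntermediateField.mem_top⟩ :
      IntermediateField.adjoin k (Set.range x))
  have hX : AlgebraicIndependent k
      fun i : ι => algebraMap _ (FractionRing (MvPolynomial ι k)) (X i : MvPolynomial ι k) :=
    (algebraicIndependent_X ι k).map' (f := Algebra.algHom k _ _) (IsFractionRing.injective _ _)
  have hindep : AlgebraicIndependent k x :=
    (Algebra.IsAlgebraic.isTranscendenceBasis_of_lift_le_trdeg_of_finite k x
      hX.lift_cardinalMk_le_trdeg).1
  have hinj : Function.Injective (aeval (R := k) x) := hindep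
  exact ⟨IsFractionRing.liftAlgHom hinj, fun i => by simp⟩

theorem exists_algHom_paramS_paramT {σ τ : FunctionField k}
    (hs : paramS k ∈ IntermediateField.adjoin k {σ, τ})
    (ht : paramT k ∈ IntermediateField.adjoin k {σ, τ}) :
    ∃ φ : FunctionField k →ₐ[k] FunctionField k, φ (paramS k) = σ ∧ φ (paramT k) = τ := by
  have htop : IntermediateField.adjoin k (Set.range ![σ, τ]) = ⊤ := by
    rw [Matrix.range_cons_cons_empty]
    refine eq_top_iff.2 fun f _ => ?_
    obtain ⟨a, b, -, rfl⟩ := IsFractionRing.div_surjective (A := MvPolynomial (Fin 2) k) f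
    have hpoly (c : MvPolynomial (Fin 2) k) :
        algebraMap _ (FunctionField k) c ∈ IntermediateField.adjoin k {σ, τ} := by
      induction c using MvPolynomial.induction_on with
      | C c => exact IntermediateField.algebraMap_mem _ c
      | add p q hp hq => exact map_add (algebraMap _ (FunctionField k)) p q ▸ add_mem hp hq
      | mul_X p i hp =>
        rw [map_mul]
        refine mul_mem hp ?_
        fin_cases i
        exacts [hs, ht]
    exact div_mem (hpoly a) (hpoly b)
  obtain ⟨φ, hφ⟩ := exists_algHom_of_adjoin_eq_top htop
  exact ⟨φ, hφ 0, hφ 1⟩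

theorem Parametrizes.subst [Infinite k] {D : RuledForm k} {S : Set (Fin 3 → k)}
    (h : Parametrizes D.toMap S) {σ τ : FunctionField k}
    (hs : paramS k ∈ IntermediateField.adjoin k {σ, τ})
    (ht : paramT k ∈ IntermediateField.adjoin k {σ, τ}) : Parametrizes (D.subst σ τ) S := by
  obtain ⟨φ, rfl, rfl⟩ := exists_algHom_paramS_paramT hs ht
  convert h.map φ
  funext i
  simp [RuledForm.toMap, RuledForm.subst, Polynomial.aeval_algHom_apply]

end Substitution

section Height

variable {R : Type*} [CommRing R] [IsDomain R]

theorem two_le_height_of_mem_of_not_dvd {f g : R} (hf : Prime f) (hfg : ¬ f ∣ g) {P : Ideal R}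
    [P.IsPrime] (hfP : f ∈ P) (hgP : g ∈ P) : 2 ≤ P.height := by
  have : (Ideal.span {f}).IsPrime := (Ideal.span_singleton_prime hf.ne_zero).2 hf
  have hbot : (⊥ : Ideal R) < Ideal.span {f} := by simpa [bot_lt_iff_ne_bot] using hf.ne_zero
  have hlt : Ideal.span {f} < P := by
    refine lt_of_le_of_ne ((Ideal.span_singleton_le_iff_mem _).2 hfP) fun h => hfg ?_
    rwa [← Ideal.mem_span_singleton, h]
  calc (2 : ℕ∞) = 0 + 1 + 1 := by norm_num
    _ ≤ (⊥ : Ideal R).height + 1 + 1 := by gcongr; exact zero_le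
    _ ≤ (Ideal.span {f}).height + 1 := by
      gcongr; exact Ideal.height_add_one_le_of_lt_of_isPrime hbot
    _ ≤ P.height := Ideal.height_add_one_le_of_lt_of_isPrime hlt

theorem eq_span_singleton_of_height_lt_two {f : R} (hf : Prime f) {P : Ideal R} [P.IsPrime]
    (hfP : f ∈ P) (hP : P.height < 2) : P = Ideal.span {f} := by
  refine le_antisymm (fun g hg => ?_) ((Ideal.span_singleton_le_iff_mem _).2 hfP)
  by_contra hfg
  rw [Ideal.mem_span_singleton] at hfg
  exact hP.not_ge (two_le_height_of_mem_of_not_dvd hf hfg hfP hg)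

theorem finite_setOf_isPrime_height_le_two [IsNoetherianRing R] {f g : R} (hf : Prime f)
    (hfg : ¬ f ∣ g) : {P : Ideal R | P.IsPrime ∧ P.height ≤ 2 ∧ f ∈ P ∧ g ∈ P}.Finite := by
  refine (Ideal.finite_minimalPrimes_of_isNoetherianRing R (Ideal.span {f, g})).subset ?_
  rintro P ⟨hP, hheight, hfP, hgP⟩
  obtain ⟨Q, hQ, hQP⟩ := Ideal.exists_minimalPrimes_le
    (show Ideal.span {f, g} ≤ P from Ideal.span_le.2 (Set.pair_subset hfP hgP))
  have := hQ.isPrime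
  obtain rfl | hlt := hQP.eq_or_lt
  · exact hQ
  have hQ2 := two_le_height_of_mem_of_not_dvd hf hfg
    (hQ.le (Ideal.subset_span (Set.mem_insert f {g})))
    (hQ.le (Ideal.subset_span (Set.mem_insert_of_mem f rfl)))
  exact absurd (Ideal.height_strict_mono_of_isPrime hlt) (hheight.trans hQ2).not_gt

end Height

section Lines

open MvPolynomial Matrix

theorem exists_eq_smul_of_cross_eq_zero {K : Type*} [Field K] {v w : Fin 3 → K} (hv : v ≠ 0)
    (h : v ⨯₃ w = 0) : ∃ a : K, w = a • v := by
  by_contra! hw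
  exact crossProduct_ne_zero_iff_linearIndependent.2
    ((LinearIndependent.pair_iff' hv).2 fun a ha => hw a ha.symm) h

/-- The restriction of a polynomial to the line through `c` in the direction `v`, as a polynomial
in the parameter of the line. -/
def restrictToLine {R σ : Type*} [CommRing R] (c v : σ → R) :
    MvPolynomial σ R →ₐ[R] Polynomial R :=
  aeval fun i => Polynomial.C (c i) + Polynomial.X * Polynomial.C (v i)

theorem eval_restrictToLine {R σ : Type*} [CommRing R] (c v : σ → R) (F : MvPolynomial σ R)
    (τ : R) : (restrictToLine c v F).eval τ = eval (c + τ • v) F := by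
  rw [← Polynomial.coe_aeval_eq_eval, restrictToLine, comp_aeval_apply, ← aeval_eq_eval]
  simp [Pi.add_def, Pi.smul_def, mul_comm τ]

variable {k : Type*} [Field k]

theorem vanishingIdeal_range_line [Infinite k] {σ : Type*} (c v : σ → k) :
    vanishingIdeal k (Set.range fun τ : k => c + τ • v) = RingHom.ker (restrictToLine c v) := by
  ext G
  simp only [mem_vanishingIdeal_iff, Set.forall_mem_range, aeval_eq_eval, RingHom.mem_ker,
    ← eval_restrictToLine]
  exact ⟨fun h => Polynomial.funext fun τ => by simp [h τ], fun h τ => by simp [h]⟩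

theorem IsLine.isPrime_vanishingIdeal [Infinite k] {L : Set (Fin 3 → k)} (hL : IsLine L) :
    (vanishingIdeal k L).IsPrime := by
  obtain ⟨c, v, -, rfl⟩ := hL
  rw [vanishingIdeal_range_line]
  exact RingHom.ker_isPrime _

theorem IsLine.zariskiClosure_eq {L : Set (Fin 3 → k)} (hL : IsLine L) : zariskiClosure L = L := by
  refine subset_antisymm (fun y hy => ?_) (zeroLocus_vanishingIdeal_le L)
  obtain ⟨c, v, hv, rfl⟩ := hL
  have hcross : v ⨯₃ (y - c) = 0 := by
    funext i
    let G := ((fun j => C (v j)) ⨯₃ (fun j => (X j - C (c j) : MvPolynomial (Fin 3) k))) i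
    have hG (x : Fin 3 → k) : eval x G = (v ⨯₃ (x - c)) i := by
      fin_cases i <;> simp [G, cross_apply]
    rw [← hG y, ← aeval_eq_eval]
    refine hy G (mem_vanishingIdeal_iff.2 ?_)
    rintro _ ⟨τ, rfl⟩
    simp [aeval_eq_eval, hG, cross_self]
  obtain ⟨τ, hτ⟩ := exists_eq_smul_of_cross_eq_zero hv hcross
  exact ⟨τ, by simp [← hτ]⟩

theorem IsLine.height_vanishingIdeal_le_two [Infinite k] {L : Set (Fin 3 → k)} (hL : IsLine L) :
    (vanishingIdeal k L).height ≤ 2 := by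
  have := hL.isPrime_vanishingIdeal
  obtain ⟨c, hc, hLc⟩ : ∃ c ∈ L, ¬ L ⊆ {c} := by
    obtain ⟨c, v, hv, rfl⟩ := hL
    refine ⟨c, ⟨0, by simp⟩, fun h => hv ?_⟩
    simpa using h ⟨1, rfl⟩
  have hlt : vanishingIdeal k L < vanishingIdeal k {c} := by
    refine lt_of_le_of_ne (vanishingIdeal_anti_mono (Set.singleton_subset_iff.2 hc)) fun h => ?_
    refine hLc fun y hy => funext fun i => ?_
    have hmem : (X i - C (c i) : MvPolynomial (Fin 3) k) ∈ vanishingIdeal (K := k) k {c} := by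
      simp [aeval_eq_eval]
    have hyc : eval y (X i - C (c i)) = 0 := (h ▸ hmem : _ ∈ vanishingIdeal k L) y hy
    simpa [sub_eq_zero] using hyc
  have hdim : (vanishingIdeal k {c}).height ≤ 3 := by
    have h : ((vanishingIdeal k {c}).height : WithBot ℕ∞) ≤ 3 :=
      Ideal.height_le_ringKrullDim_of_isPrime.trans_eq
        (by simp [ringKrullDim_of_isNoetherianRing])
    exact WithBot.coe_le_coe.1 h
  refine ENat.lt_add_one_iff (by simp) |>.1 ((Ideal.height_strict_mono_of_isPrime hlt).trans_le ?_)
  exact hdim.trans_eq (by norm_num)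

theorem parametrizes_of_isLine_subset_image [IsAlgClosed k] {F : MvPolynomial (Fin 3) k}
    (hF : Irreducible F) {P : Fin 3 → FunctionField k} (hFP : aeval P F = 0)
    {L : Set (Fin 3 → k)} (hL : IsLine L) (hLP : L ⊆ image P) (hPL : ¬ image P ⊆ L) :
    Parametrizes P {x | eval x F = 0} := by
  have := RingHom.ker_isPrime (aeval (R := k) P)
  have := hL.isPrime_vanishingIdeal
  have hlt : RingHom.ker (aeval (R := k) P) < vanishingIdeal k L := by
    rw [← vanishingIdeal_image]
    refine lt_of_le_of_ne (vanishingIdeal_anti_mono hLP) fun h => hPL ?_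
    rw [← hL.zariskiClosure_eq, zariskiClosure, ← h]
    exact zeroLocus_vanishingIdeal_le _
  rw [parametrizes_iff_ker_eq_span hF]
  exact eq_span_singleton_of_height_lt_two hF.prime hFP
    ((Ideal.height_strict_mono_of_isPrime hlt).trans_le hL.height_vanishingIdeal_le_two)

theorem dvd_of_infinite_setOf_isLine [Infinite k] {F G : MvPolynomial (Fin 3) k}
    (hF : Irreducible F)
    (h : {L | IsLine L ∧ ∀ x ∈ L, eval x F = 0 ∧ eval x G = 0}.Infinite) : F ∣ G := by
  by_contra hFG
  refine h (Set.Finite.of_finite_image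
    ((finite_setOf_isPrime_height_le_two hF.prime hFG).subset ?_) (f := vanishingIdeal k) ?_)
  · rintro _ ⟨L, ⟨hL, hFGL⟩, rfl⟩
    refine ⟨hL.isPrime_vanishingIdeal, hL.height_vanishingIdeal_le_two, ?_, ?_⟩
    · exact mem_vanishingIdeal_iff.2 fun x hx => by rw [aeval_eq_eval, (hFGL x hx).1]
    · exact mem_vanishingIdeal_iff.2 fun x hx => by rw [aeval_eq_eval, (hFGL x hx).2]
  · rintro L ⟨hL, -⟩ M ⟨hM, -⟩ hLM
    rw [← hL.zariskiClosure_eq, ← hM.zariskiClosure_eq, zariskiClosure, hLM]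
    rfl

end Lines

section GenericRoots

open Polynomial

theorem exists_ne_eval₂_eq_zero_of_separable_map {R k : Type*} [CommRing R] [Field k]
    [IsAlgClosed k] {f : R[X]} {ε : R →+* k}
    (hf : (f.map ε).Separable) (hdeg : 1 < f.natDegree) (hε : ε f.leadingCoeff ≠ 0) :
    ∃ α β, α ≠ β ∧ f.eval₂ ε α = 0 ∧ f.eval₂ ε β = 0 := by
  classical
  have hcard : 1 < (f.map ε).roots.toFinset.card := by
    rwa [Multiset.toFinset_card_of_nodup (nodup_roots hf),
      ← (IsAlgClosed.splits (f.map ε)).natDegree_eq_card_roots,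
      natDegree_map_of_leadingCoeff_ne_zero ε hε]
  have hroot (α) (hα : α ∈ (f.map ε).roots.toFinset) : f.eval₂ ε α = 0 := by
    simpa [eval_map] using isRoot_of_mem_roots (Multiset.mem_toFinset.1 hα)
  obtain ⟨α, hα, β, hβ, hαβ⟩ := Finset.one_lt_card.1 hcard
  exact ⟨α, β, hαβ, hroot α hα, hroot β hβ⟩

variable {R K k : Type*} [CommRing R] [IsDomain R] [Field K] [Algebra R K] [IsFractionRing R K]
  [Field k]

theorem exists_mem_map_eq_C_mul {J : Ideal R[X]} {y : K[X]}
    (hy : y ∈ J.map (mapRingHom (algebraMap R K))) :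
    ∃ d : R, d ≠ 0 ∧ ∃ f ∈ J, f.map (algebraMap R K) = C (algebraMap R K d) * y := by
  let : Algebra R[X] K[X] := Polynomial.algebra R K
  have := Polynomial.isLocalization (nonZeroDivisors R) K
  obtain ⟨⟨f, ⟨_, ⟨d, hd, rfl⟩⟩⟩, h⟩ := (IsLocalization.mem_map_algebraMap_iff
    ((nonZeroDivisors R).map (C : R →+* R[X])) K[X]).1 hy
  refine ⟨d, nonZeroDivisors.ne_zero hd, f, f.2, ?_⟩
  rw [mul_comm, ← map_C]
  exact h.symm

variable (K) in
theorem exists_dvd_C_mul_of_map_dvd_map {f g : R[X]}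
    (h : f.map (algebraMap R K) ∣ g.map (algebraMap R K)) : ∃ d : R, d ≠ 0 ∧ f ∣ C d * g := by
  have hg : g.map (algebraMap R K) ∈ (Ideal.span {f}).map (mapRingHom (algebraMap R K)) := by
    rwa [Ideal.map_span, Set.image_singleton, Ideal.mem_span_singleton]
  obtain ⟨d, hd, f', hf', h'⟩ := exists_mem_map_eq_C_mul hg
  rw [← map_C, ← Polynomial.map_mul] at h'
  rw [map_injective _ (IsFractionRing.injective R K) h', Ideal.mem_span_singleton] at hf'
  exact ⟨d, hd, hf'⟩

theorem exists_mem_forall_dvd_C_mul {J : Ideal R[X]} (hJ : J.FG) :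
    ∃ h ∈ J, ∃ d : R, d ≠ 0 ∧ ∀ f ∈ J, h ∣ C d * f := by
  let K := FractionRing R
  obtain ⟨y, hy⟩ := (IsPrincipalIdealRing.principal
    (J.map (mapRingHom (algebraMap R K)))).principal
  rw [Ideal.submodule_span_eq] at hy
  obtain ⟨c, hc, h, hJh, hh⟩ := exists_mem_map_eq_C_mul
    (hy ▸ Ideal.mem_span_singleton_self y : y ∈ J.map (mapRingHom (algebraMap R K)))
  have hcK : IsUnit (C (algebraMap R K c)) := isUnit_C.2 (IsUnit.mk0 _ (by simpa [K] using hc))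
  have hdvd (f : R[X]) (hf : f ∈ J) : ∃ d : R, d ≠ 0 ∧ h ∣ C d * f := by
    refine exists_dvd_C_mul_of_map_dvd_map K ?_
    rw [hh, hcK.mul_left_dvd, ← Ideal.mem_span_singleton, ← hy]
    exact Ideal.mem_map_of_mem (mapRingHom (algebraMap R K)) hf
  choose! d hd hdf using hdvd
  obtain ⟨T, rfl⟩ := hJ
  have hT (f) (hf : f ∈ T) : f ∈ Ideal.span (T : Set R[X]) := Ideal.subset_span hf
  refine ⟨h, hJh, ∏ f ∈ T, d f, Finset.prod_ne_zero_iff.2 fun f hf => hd f (hT f hf), ?_⟩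
  suffices Ideal.span (T : Set R[X]) ≤
      (Ideal.span {h}).colon {C (∏ f ∈ T, d f)} from fun f hf => by
    simpa [Submodule.mem_colon_singleton, Ideal.mem_span_singleton, mul_comm] using this hf
  refine Ideal.span_le.2 fun f hf => ?_
  rw [SetLike.mem_coe, Submodule.mem_colon_singleton, smul_eq_mul, mul_comm,
    Ideal.mem_span_singleton]
  exact (hdf f (hT f hf)).trans
    (mul_dvd_mul_right (_root_.map_dvd C (Finset.dvd_prod_of_mem d hf)) f)

theorem exists_forall_le_ker_iff_eval₂_eq_zero (k : Type*) [Field k] {J : Ideal R[X]}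
    (hJ : J.FG) : ∃ h : R[X], ∃ d : R, d ≠ 0 ∧ ∀ ε : R →+* k, ε d ≠ 0 → ∀ α,
      J ≤ RingHom.ker (eval₂RingHom ε α) ↔ h.eval₂ ε α = 0 := by
  obtain ⟨h, hJh, d, hd, hdvd⟩ := exists_mem_forall_dvd_C_mul hJ
  refine ⟨h, d, hd, fun ε hε α => ⟨fun hα => hα hJh, fun hα f hf => ?_⟩⟩
  have h0 := eval₂_eq_zero_of_dvd_of_eval₂_eq_zero ε α (hdvd f hf) hα
  rw [eval₂_mul, eval₂_C] at h0
  exact (mul_eq_zero.1 h0).resolve_left hε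

variable (K) in
theorem exists_forall_separable_map {f : R[X]} (hf : (f.map (algebraMap R K)).Separable) :
    ∃ d : R, d ≠ 0 ∧ ∀ ε : R →+* k, ε d ≠ 0 → (f.map ε).Separable := by
  have h1 : (1 : K[X]) ∈
      (Ideal.span {f, derivative f}).map (mapRingHom (algebraMap R K)) := by
    obtain ⟨a, b, hab⟩ := hf
    rw [Ideal.map_span, Set.image_pair, coe_mapRingHom, ← derivative_map]
    exact Ideal.mem_span_pair.2 ⟨a, b, hab⟩
  obtain ⟨d, hd, g, hg, hgd⟩ := exists_mem_map_eq_C_mul h1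
  rw [mul_one, ← map_C] at hgd
  rw [map_injective _ (IsFractionRing.injective R K) hgd, Ideal.mem_span_pair] at hg
  obtain ⟨a, b, hab⟩ := hg
  refine ⟨d, hd, fun ε hε => ⟨C (ε d)⁻¹ * a.map ε, C (ε d)⁻¹ * b.map ε, ?_⟩⟩
  rw [derivative_map, mul_assoc, mul_assoc, ← mul_add, ← Polynomial.map_mul, ← Polynomial.map_mul,
    ← Polynomial.map_add, hab, map_C, ← C_mul, inv_mul_cancel₀ hε, C_1]

theorem exists_forall_eval₂_div_eq_zero {h : R[X]} {x : K}
    (hx : (h.map (algebraMap R K)).IsRoot x) :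
    ∃ p₀ p₁ d : R, d ≠ 0 ∧ ∀ ε : R →+* k, ε d ≠ 0 → ε p₁ ≠ 0 ∧ h.eval₂ ε (ε p₀ / ε p₁) = 0 := by
  obtain ⟨p₀, p₁, hp₁, rfl⟩ := IsFractionRing.div_surjective (A := R) x
  have hp₁K : algebraMap R K p₁ ≠ 0 :=
    IsFractionRing.to_map_ne_zero_of_mem_nonZeroDivisors hp₁
  have hdvd : (C p₁ * X - C p₀).map (algebraMap R K) ∣ h.map (algebraMap R K) := by
    have hunit : IsUnit (C (algebraMap R K p₁)) := isUnit_C.2 hp₁K.isUnit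
    have heq : (C p₁ * X - C p₀).map (algebraMap R K) =
        C (algebraMap R K p₁) * (X - C (algebraMap R K p₀ / algebraMap R K p₁)) := by
      rw [mul_sub, ← C_mul, mul_div_cancel₀ _ hp₁K]
      simp
    rw [heq, hunit.mul_left_dvd]
    exact dvd_iff_isRoot.2 hx
  obtain ⟨d, hd, hdh⟩ := exists_dvd_C_mul_of_map_dvd_map K hdvd
  refine ⟨p₀, p₁, d * p₁, mul_ne_zero hd (nonZeroDivisors.ne_zero hp₁), fun ε hε => ?_⟩
  rw [map_mul] at hε
  have hε₁ := right_ne_zero_of_mul hε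
  have h0 := eval₂_eq_zero_of_dvd_of_eval₂_eq_zero ε (ε p₀ / ε p₁) hdh
    (by simp [mul_div_cancel₀ _ hε₁])
  rw [eval₂_mul, eval₂_C] at h0
  exact ⟨hε₁, (mul_eq_zero.1 h0).resolve_left (left_ne_zero_of_mul hε)⟩

variable (K) in
theorem exists_forall_two_roots [IsAlgClosed k] [CharZero K] {h : R[X]} (hdeg : h.natDegree ≠ 0)
    (hroot : ∀ x : K, ¬ (h.map (algebraMap R K)).IsRoot x) :
    ∃ d : R, d ≠ 0 ∧ ∀ ε : R →+* k, ε d ≠ 0 →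
      ∃ α β, α ≠ β ∧ h.eval₂ ε α = 0 ∧ h.eval₂ ε β = 0 := by
  have hinj := IsFractionRing.injective R K
  obtain ⟨π, hπ, hπh⟩ := exists_irreducible_of_natDegree_ne_zero
    ((natDegree_map_eq_of_injective hinj h).trans_ne hdeg)
  obtain ⟨c, hc, ϖ, -, hϖ⟩ := exists_mem_map_eq_C_mul (R := R) (J := ⊤) (y := π)
    (by simp [Ideal.map_top])
  have hcK : IsUnit (C (algebraMap R K c)) := by simpa using hc
  have hassoc : Associated π (ϖ.map (algebraMap R K)) := by
    rw [hϖ]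
    exact (associated_isUnit_mul_left_iff hcK).2 (Associated.refl π) |>.symm
  have hirr := hassoc.irreducible hπ
  have hϖh := hassoc.symm.dvd.trans hπh
  have hdegϖ : 1 < ϖ.natDegree := by
    rw [← natDegree_map_eq_of_injective hinj ϖ]
    refine lt_of_le_of_ne hirr.natDegree_pos fun h1 => ?_
    obtain ⟨x, hx⟩ := exists_root_of_degree_eq_one
      ((degree_eq_iff_natDegree_eq_of_pos one_pos).2 h1.symm)
    exact hroot x (hx.dvd hϖh)
  obtain ⟨d, hd, hdh⟩ := exists_dvd_C_mul_of_map_dvd_map K hϖh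
  obtain ⟨e, he, hsep⟩ := exists_forall_separable_map (k := k) K hirr.separable
  have hlc : ϖ.leadingCoeff ≠ 0 := leadingCoeff_ne_zero.2 (by rintro rfl; simp at hdegϖ)
  refine ⟨d * (e * ϖ.leadingCoeff), mul_ne_zero hd (mul_ne_zero he hlc), fun ε hε => ?_⟩
  simp only [map_mul, mul_ne_zero_iff] at hε
  have hkill (α) (hα : ϖ.eval₂ ε α = 0) : h.eval₂ ε α = 0 := by
    have h0 := eval₂_eq_zero_of_dvd_of_eval₂_eq_zero ε α hdh hα
    rw [eval₂_mul, eval₂_C] at h0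
    exact (mul_eq_zero.1 h0).resolve_left hε.1
  obtain ⟨α, β, hαβ, hα, hβ⟩ :=
    exists_ne_eval₂_eq_zero_of_separable_map (hsep ε hε.2.1) hdegϖ hε.2.2
  exact ⟨α, β, hαβ, hkill α hα, hkill β hβ⟩

/-- Over the fraction field of `R`, the gcd of `J` has a root in that field, or is a nonzero
constant, or has an irreducible factor of degree at least two. -/
theorem generic_common_roots [IsAlgClosed k] [CharZero R] {J : Ideal R[X]} (hJ : J.FG) :
    (∃ d : R, d ≠ 0 ∧ ∀ ε : R →+* k, ε d ≠ 0 → ∀ α, ¬ J ≤ RingHom.ker (eval₂RingHom ε α)) ∨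
    (∃ p₀ p₁ d : R, d ≠ 0 ∧ ∀ ε : R →+* k, ε d ≠ 0 →
      ε p₁ ≠ 0 ∧ J ≤ RingHom.ker (eval₂RingHom ε (ε p₀ / ε p₁))) ∨
    (∃ d : R, d ≠ 0 ∧ ∀ ε : R →+* k, ε d ≠ 0 → ∃ α β, α ≠ β ∧
      J ≤ RingHom.ker (eval₂RingHom ε α) ∧ J ≤ RingHom.ker (eval₂RingHom ε β)) := by
  let K := FractionRing R
  have : CharZero K := charZero_of_injective_algebraMap (IsFractionRing.injective R K)
  obtain ⟨h, c, hc, hiff⟩ := exists_forall_le_ker_iff_eval₂_eq_zero k hJ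
  by_cases hroot : ∃ x : K, (h.map (algebraMap R K)).IsRoot x
  · obtain ⟨x, hx⟩ := hroot
    obtain ⟨p₀, p₁, d, hd, hp⟩ := exists_forall_eval₂_div_eq_zero (k := k) hx
    refine .inr (.inl ⟨p₀, p₁, c * d, mul_ne_zero hc hd, fun ε hε => ?_⟩)
    rw [map_mul, mul_ne_zero_iff] at hε
    exact ⟨(hp ε hε.2).1, (hiff ε hε.1 _).2 (hp ε hε.2).2⟩
  rw [not_exists] at hroot
  by_cases hdeg : h.natDegree = 0
  · obtain ⟨a, rfl⟩ := natDegree_eq_zero.1 hdeg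
    have ha : a ≠ 0 := by rintro rfl; exact hroot 0 (by simp)
    refine .inl ⟨c * a, mul_ne_zero hc ha, fun ε hε α hα => ?_⟩
    rw [map_mul, mul_ne_zero_iff] at hε
    exact hε.2 (by simpa using (hiff ε hε.1 α).1 hα)
  · obtain ⟨d, hd, htwo⟩ := exists_forall_two_roots (k := k) K hdeg hroot
    refine .inr (.inr ⟨c * d, mul_ne_zero hc hd, fun ε hε => ?_⟩)
    rw [map_mul, mul_ne_zero_iff] at hε
    obtain ⟨α, β, hαβ, hα, hβ⟩ := htwo ε hε.2
    exact ⟨α, β, hαβ, (hiff ε hε.1 α).2 hα, (hiff ε hε.1 β).2 hβ⟩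

theorem generic_common_roots_on_hypersurface {σ : Type*} [Finite σ] [IsAlgClosed k] [CharZero k]
    {F : MvPolynomial σ k} (hF : Irreducible F) (J : Ideal (MvPolynomial σ k)[X]) :
    (∃ d, ¬ F ∣ d ∧ ∀ x, MvPolynomial.eval x F = 0 → MvPolynomial.eval x d ≠ 0 → ∀ α,
      ¬ J ≤ RingHom.ker (eval₂RingHom (MvPolynomial.eval x) α)) ∨
    (∃ p₀ p₁ d, ¬ F ∣ d ∧ ∀ x, MvPolynomial.eval x F = 0 → MvPolynomial.eval x d ≠ 0 →
      MvPolynomial.eval x p₁ ≠ 0 ∧ J ≤ RingHom.ker (eval₂RingHom (MvPolynomial.eval x)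
        (MvPolynomial.eval x p₀ / MvPolynomial.eval x p₁))) ∨
    (∃ d, ¬ F ∣ d ∧ ∀ x, MvPolynomial.eval x F = 0 → MvPolynomial.eval x d ≠ 0 → ∃ α β, α ≠ β ∧
      J ≤ RingHom.ker (eval₂RingHom (MvPolynomial.eval x) α) ∧
      J ≤ RingHom.ker (eval₂RingHom (MvPolynomial.eval x) β)) := by
  have : (Ideal.span {F}).IsPrime := (Ideal.span_singleton_prime hF.ne_zero).2 hF.prime
  let mk := Ideal.Quotient.mk (Ideal.span {F})
  have : CharZero (MvPolynomial σ k ⧸ Ideal.span {F}) :=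
    charZero_of_injective_algebraMap (algebraMap k _).injective
  have hmk (d) : mk d ≠ 0 ↔ ¬ F ∣ d := by
    rw [Ne, Ideal.Quotient.eq_zero_iff_mem, Ideal.mem_span_singleton]
  have hlift (x) (hx : MvPolynomial.eval x F = 0) :
      ∃ ε : MvPolynomial σ k ⧸ Ideal.span {F} →+* k, ∀ d, ε (mk d) = MvPolynomial.eval x d :=
    ⟨Ideal.Quotient.lift _ (MvPolynomial.eval x) fun f hf => by
      simpa using (Ideal.span_singleton_le_iff_mem (RingHom.ker (MvPolynomial.eval x))).2 hx hf,
      fun d => Ideal.Quotient.lift_mk _ _ _⟩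
  have hJ (x) (ε : MvPolynomial σ k ⧸ Ideal.span {F} →+* k)
      (hε : ∀ d, ε (mk d) = MvPolynomial.eval x d) (α) :
      J.map (mapRingHom mk) ≤ RingHom.ker (eval₂RingHom ε α) ↔
        J ≤ RingHom.ker (eval₂RingHom (MvPolynomial.eval x) α) := by
    have hcomp : (eval₂RingHom ε α).comp (mapRingHom mk) =
        eval₂RingHom (MvPolynomial.eval x) α := by ext <;> simp [hε]
    rw [Ideal.map_le_iff_le_comap, RingHom.comap_ker, hcomp]
  rcases generic_common_roots (k := k) (IsNoetherian.noetherian (J.map (mapRingHom mk))) with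
    ⟨d, hd, H⟩ | ⟨p₀, p₁, d, hd, H⟩ | ⟨d, hd, H⟩
  · obtain ⟨d, rfl⟩ := Ideal.Quotient.mk_surjective d
    refine .inl ⟨d, (hmk d).1 hd, fun x hx hdx α => ?_⟩
    obtain ⟨ε, hε⟩ := hlift x hx
    rw [← hJ x ε hε]
    exact H ε (by rwa [← hε] at hdx) α
  · obtain ⟨d, rfl⟩ := Ideal.Quotient.mk_surjective d
    obtain ⟨p₀, rfl⟩ := Ideal.Quotient.mk_surjective p₀
    obtain ⟨p₁, rfl⟩ := Ideal.Quotient.mk_surjective p₁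
    refine .inr (.inl ⟨p₀, p₁, d, (hmk d).1 hd, fun x hx hdx => ?_⟩)
    obtain ⟨ε, hε⟩ := hlift x hx
    rw [← hJ x ε hε, ← hε, ← hε]
    exact H ε (by rwa [← hε] at hdx)
  · obtain ⟨d, rfl⟩ := Ideal.Quotient.mk_surjective d
    refine .inr (.inr ⟨d, (hmk d).1 hd, fun x hx hdx => ?_⟩)
    obtain ⟨ε, hε⟩ := hlift x hx
    simp only [← hJ x ε hε]
    exact H ε (by rwa [← hε] at hdx)

end GenericRoots

section Gradient

open MvPolynomial Matrix

variable {R σ : Type*} [CommRing R]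

/-- The gradient of a polynomial, as the vector of its partial derivatives. -/
def grad (F : MvPolynomial σ R) : σ → MvPolynomial σ R :=
  fun i => pderiv i F

theorem degreeOf_pderiv_lt {F : MvPolynomial σ R} {i : σ} (h : F.degreeOf i ≠ 0) :
    (pderiv i F).degreeOf i < F.degreeOf i := by
  rw [degreeOf_lt_iff (Nat.pos_of_ne_zero h)]
  intro m hm
  rw [mem_support_iff, coeff_pderiv] at hm
  have hle := monomial_le_degreeOf i (mem_support_iff.2 (left_ne_zero_of_mul hm))
  simp only [Finsupp.add_apply, Finsupp.single_eq_same] at hle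
  lia

theorem pderiv_ne_zero_of_mem_vars [NoZeroDivisors R] [CharZero R] {F : MvPolynomial σ R} {i : σ}
    (h : i ∈ F.vars) : pderiv i F ≠ 0 := by
  obtain ⟨m, hm, hmi⟩ := (mem_vars_iff_mem_support i).1 h
  have hle : Finsupp.single i 1 ≤ m :=
    Finsupp.single_le_iff.2 (Nat.one_le_iff_ne_zero.2 (Finsupp.mem_support_iff.1 hmi))
  refine ne_zero_iff.2 ⟨m - Finsupp.single i 1, ?_⟩
  rw [coeff_pderiv, tsub_add_cancel_of_le hle]
  exact mul_ne_zero (mem_support_iff.1 hm) (Nat.cast_add_one_ne_zero _)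

theorem exists_not_dvd_pderiv {k : Type*} [Field k] [CharZero k] {F : MvPolynomial σ k}
    (hF : Irreducible F) : ∃ i, ¬ F ∣ pderiv i F := by
  obtain ⟨i, hi⟩ : F.vars.Nonempty := by
    rw [Finset.nonempty_iff_ne_empty]
    intro h
    have hFC := vars_eq_empty_iff_eq_C.1 h
    refine hF.not_isUnit (hFC ▸ IsUnit.map C (IsUnit.mk0 _ fun h0 => hF.ne_zero ?_))
    rw [hFC, h0, C_0]
  refine ⟨i, ?_⟩
  rintro ⟨H, hH⟩
  have hlt := degreeOf_pderiv_lt (mem_vars_iff_degreeOf_ne_zero.1 hi)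
  have hH0 : H ≠ 0 := by
    rintro rfl
    exact pderiv_ne_zero_of_mem_vars hi (by rw [hH, mul_zero])
  rw [hH, degreeOf_mul_eq hF.ne_zero hH0] at hlt
  lia

theorem map_restrictToLine {R' : Type*} [CommRing R'] (φ : R →+* R') (c v : σ → R)
    (F : MvPolynomial σ R) :
    (restrictToLine c v F).map φ = restrictToLine (φ ∘ c) (φ ∘ v) (map φ F) := by
  have h : (Polynomial.mapRingHom φ).comp (restrictToLine c v : MvPolynomial σ R →+* Polynomial R) =
      (restrictToLine (φ ∘ c) (φ ∘ v) : MvPolynomial σ R' →+* Polynomial R').comp (map φ) := by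
    ext <;> simp [restrictToLine]
  exact congr($h F)

theorem restrictToLine_smul (a : R) (c v : σ → R) (F : MvPolynomial σ R) :
    restrictToLine c (a • v) F = (restrictToLine c v F).comp (Polynomial.C a * Polynomial.X) := by
  have h : restrictToLine c (a • v) =
      (Polynomial.aeval (Polynomial.C a * Polynomial.X)).comp (restrictToLine c v) := by
    refine algHom_ext fun i => ?_
    simp only [restrictToLine, aeval_X, AlgHom.comp_apply, map_add, map_mul, Polynomial.aeval_C,
      Polynomial.aeval_X, Pi.smul_apply, smul_eq_mul, Polynomial.algebraMap_eq]
    ring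
  exact congr($h F)

theorem derivative_restrictToLine [Fintype σ] (c v : σ → R) (F : MvPolynomial σ R) :
    Polynomial.derivative (restrictToLine c v F) =
      (Polynomial.C ∘ v) ⬝ᵥ (restrictToLine c v ∘ grad F) := by
  classical
  have hX (i : σ) : restrictToLine c v (X i) =
      Polynomial.C (c i) + Polynomial.X * Polynomial.C (v i) := aeval_X _ _
  simp only [dotProduct, grad, Function.comp_apply]
  induction F using MvPolynomial.induction_on with
  | C a => simp [restrictToLine]
  | add p q hp hq => simp [hp, hq, mul_add, Finset.sum_add_distrib]
  | mul_X p i hp =>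
    have hsingle (j : σ) : restrictToLine c v (pderiv j (X i)) = if i = j then 1 else 0 := by
      rw [pderiv_X, Pi.single_apply]
      split_ifs <;> simp
    simp only [map_mul, Polynomial.derivative_mul, hp, hX, pderiv_mul, map_add, hsingle, mul_add,
      Finset.sum_add_distrib, Finset.sum_mul, mul_ite, mul_one, mul_zero, Finset.sum_ite_eq,
      Finset.mem_univ, if_true, mul_assoc]
    simp only [Polynomial.derivative_C, Polynomial.derivative_X, mul_zero, one_mul, add_zero]
    ring

end Gradient

section Directions

open MvPolynomial Matrix

theorem map_cross {R R' : Type*} [CommRing R] [CommRing R'] (φ : R →+* R') (v w : Fin 3 → R) :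
    φ ∘ (v ⨯₃ w) = (φ ∘ v) ⨯₃ (φ ∘ w) := by
  funext i
  fin_cases i <;> simp [cross_apply]

theorem cross_cross_cross_self {R : Type*} [CommRing R] (n v w : Fin 3 → R) :
    (n ⨯₃ v) ⨯₃ (n ⨯₃ w) = (n ⬝ᵥ (v ⨯₃ w)) • n := by
  rw [cross_cross_eq_smul_sub_smul', dot_self_cross, zero_smul, sub_zero, dotProduct_comm,
    triple_product_permutation]

variable {k : Type*} [Field k]

theorem dotProduct_grad_eq_zero {σ : Type*} [Fintype σ] {F : MvPolynomial σ k} {x v : σ → k}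
    (h : restrictToLine x v F = 0) : v ⬝ᵥ (eval x ∘ grad F) = 0 := by
  have h0 := congrArg (Polynomial.eval 0) (derivative_restrictToLine x v F)
  simpa [h, dotProduct, Polynomial.eval_finsetSum, eval_restrictToLine] using h0.symm

theorem exists_cross_eq_smul {n v e e' : Fin 3 → k} (hv : v ≠ 0) (hvn : v ⬝ᵥ n = 0)
    (hn : n ⬝ᵥ (e ⨯₃ e') ≠ 0) :
    (∃ α c : k, n ⨯₃ (e' + α • e) = c • v) ∨ ∃ c : k, n ⨯₃ e = c • v := by
  have key : n ⨯₃ ((v ⬝ᵥ e') • e - (v ⬝ᵥ e) • e') = (n ⬝ᵥ (e ⨯₃ e')) • v := by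
    have h := cross_cross_eq_smul_sub_smul' v e e'
    rw [dotProduct_comm e v] at h
    rw [← h, cross_cross_eq_smul_sub_smul', hvn, zero_smul, sub_zero]
  by_cases hve : v ⬝ᵥ e = 0
  · have hve' : v ⬝ᵥ e' ≠ 0 := by
      intro h
      simp only [h, hve, zero_smul, sub_zero, map_zero] at key
      exact smul_ne_zero hn hv key.symm
    refine .inr ⟨(v ⬝ᵥ e')⁻¹ * (n ⬝ᵥ (e ⨯₃ e')), ?_⟩
    rw [mul_smul, ← key, hve, zero_smul, sub_zero, map_smul, inv_smul_smul₀ hve']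
  · refine .inl ⟨-(v ⬝ᵥ e)⁻¹ * (v ⬝ᵥ e'), -(v ⬝ᵥ e)⁻¹ * (n ⬝ᵥ (e ⨯₃ e')), ?_⟩
    rw [mul_smul _ _ v, ← key, ← map_smul, smul_sub, smul_smul, smul_smul, neg_mul _ (v ⬝ᵥ e),
      inv_mul_cancel₀ hve, neg_one_smul, sub_neg_eq_add, add_comm]

/-- The restriction of `F` to the line through a generic point `x` in the direction
`∇F ⨯₃ (e' + α • e)`, as a polynomial in the parameter of the line; its coefficients are polynomials
in the slope `α` over the polynomial ring in the coordinates of `x`. -/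
def pencilRestriction (F : MvPolynomial (Fin 3) k) (e e' : Fin 3 → k) :
    Polynomial (Polynomial (MvPolynomial (Fin 3) k)) :=
  let ι : k →+* Polynomial (MvPolynomial (Fin 3) k) := Polynomial.C.comp C
  restrictToLine (Polynomial.C ∘ X)
    ((Polynomial.C ∘ grad F) ⨯₃
      (ι ∘ e' + (Polynomial.X : Polynomial (MvPolynomial (Fin 3) k)) • (ι ∘ e))) (map ι F)

theorem map_pencilRestriction (F : MvPolynomial (Fin 3) k) (e e' x : Fin 3 → k) (α : k) :
    (pencilRestriction F e e').map (Polynomial.eval₂RingHom (eval x) α) =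
      restrictToLine x ((eval x ∘ grad F) ⨯₃ (e' + α • e)) F := by
  let φ := Polynomial.eval₂RingHom (eval x) α
  let ι : k →+* Polynomial (MvPolynomial (Fin 3) k) := Polynomial.C.comp C
  have hι : φ.comp ι = RingHom.id k := by ext a; simp [φ, ι]
  have hX : φ ∘ Polynomial.C ∘ X = x := by funext i; simp [φ]
  have hgrad : φ ∘ Polynomial.C ∘ grad F = eval x ∘ grad F := by funext i; simp [φ]
  have he : φ ∘ (ι ∘ e' + (Polynomial.X : Polynomial (MvPolynomial (Fin 3) k)) • (ι ∘ e)) =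
      e' + α • e := by
    funext i; simpa [φ, ι] using mul_comm _ _
  change Polynomial.map φ (restrictToLine _ (_ ⨯₃ (ι ∘ e' + _ • (ι ∘ e))) (map ι F)) = _
  rw [map_restrictToLine, map_cross, MvPolynomial.map_map, hX, hgrad, he, hι,
    MvPolynomial.map_id]

theorem span_coeff_pencilRestriction_le_ker_iff {F : MvPolynomial (Fin 3) k} {e e' x : Fin 3 → k}
    {α : k} : Ideal.span (Set.range (pencilRestriction F e e').coeff) ≤
        RingHom.ker (Polynomial.eval₂RingHom (eval x) α) ↔
      restrictToLine x ((eval x ∘ grad F) ⨯₃ (e' + α • e)) F = 0 := by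
  rw [← map_pencilRestriction, Ideal.span_le, Set.range_subset_iff, Polynomial.ext_iff]
  simp

theorem cross_add_smul_ne_zero {n e e' : Fin 3 → k} (hn : n ⬝ᵥ (e ⨯₃ e') ≠ 0) (α : k) :
    n ⨯₃ (e' + α • e) ≠ 0 := by
  intro h
  have h0 : e ⬝ᵥ (n ⨯₃ (e' + α • e)) = 0 := by rw [h, dotProduct_zero]
  rw [triple_product_permutation, map_add, LinearMap.add_apply, map_smul, LinearMap.smul_apply,
    cross_self, smul_zero, add_zero, ← cross_anticomm, dotProduct_neg, neg_eq_zero] at h0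
  exact hn h0

theorem cross_cross_cross_add_smul_ne_zero {n e e' : Fin 3 → k} (hn : n ⬝ᵥ (e ⨯₃ e') ≠ 0)
    {α β : k} (hαβ : α ≠ β) : (n ⨯₃ (e' + α • e)) ⨯₃ (n ⨯₃ (e' + β • e)) ≠ 0 := by
  have hn0 : n ≠ 0 := by rintro rfl; simp at hn
  have hcross : (e' + α • e) ⨯₃ (e' + β • e) = (α - β) • (e ⨯₃ e') := by
    simp only [map_add, map_smul, LinearMap.add_apply, LinearMap.smul_apply, cross_self, smul_zero,
      zero_add, add_zero, ← cross_anticomm e e', smul_neg, sub_smul]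
    abel
  rw [cross_cross_cross_self, hcross, dotProduct_smul, smul_eq_mul]
  exact smul_ne_zero (mul_ne_zero (sub_ne_zero.2 hαβ) hn) hn0

theorem restrictToLine_zero {σ : Type*} {F : MvPolynomial σ k} {x : σ → k} (hx : eval x F = 0) :
    restrictToLine x 0 F = 0 := by
  have h := restrictToLine_smul 0 x 0 F
  rw [zero_smul, map_zero, zero_mul, Polynomial.comp_zero, eval_restrictToLine, smul_zero, add_zero,
    hx, map_zero] at h
  exact h

theorem restrictToLine_eq_zero_of_smul {σ : Type*} {F : MvPolynomial σ k} {x v w : σ → k} {c : k}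
    (h : restrictToLine x v F = 0) (hw : w = c • v) : restrictToLine x w F = 0 := by
  rw [hw, restrictToLine_smul, h, Polynomial.zero_comp]

theorem exists_cross_single_eq_single (j : Fin 3) :
    ∃ e e' : Fin 3 → k, e ⨯₃ e' = Pi.single j 1 := by
  refine ⟨Pi.single (j + 1) 1, Pi.single (j + 2) 1, funext fun i => ?_⟩
  fin_cases j <;> fin_cases i <;> simp [cross_apply]

variable (F : MvPolynomial (Fin 3) k) (V : Fin 3 → MvPolynomial (Fin 3) k) in
/-- A polynomial vector field that does not vanish identically on the surface `F = 0` and whose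
value at each point, unless it is zero, is the direction of a line contained in the surface. -/
structure IsRulingField : Prop where
  exists_not_dvd : ∃ i, ¬ F ∣ V i
  restrictToLine_eq_zero : ∀ x, eval x F = 0 → restrictToLine x (eval x ∘ V) F = 0

theorem IsRulingField.of_generic [IsAlgClosed k] {F : MvPolynomial (Fin 3) k} (hF : Irreducible F)
    {g : MvPolynomial (Fin 3) k} (hg : ¬ F ∣ g) {V : Fin 3 → MvPolynomial (Fin 3) k}
    (hV : ∀ x, eval x F = 0 → eval x g ≠ 0 →
      eval x ∘ V ≠ 0 ∧ restrictToLine x (eval x ∘ V) F = 0) : IsRulingField F (g • V) where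
  exists_not_dvd := by
    obtain ⟨x, hx, hgx⟩ : ∃ x, eval x F = 0 ∧ eval x g ≠ 0 := by
      simpa [dvd_iff_forall_eval_eq_zero hF] using hg
    obtain ⟨i, hi⟩ := Function.ne_iff.1 (hV x hx hgx).1
    refine ⟨i, fun h => mul_ne_zero hgx hi ?_⟩
    simpa using (dvd_iff_forall_eval_eq_zero hF).1 h x hx
  restrictToLine_eq_zero x hx := by
    have hsmul : eval x ∘ (g • V) = eval x g • (eval x ∘ V) := funext fun i => by simp
    by_cases hgx : eval x g = 0
    · rw [hsmul, hgx, zero_smul]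
      exact restrictToLine_zero hx
    · exact restrictToLine_eq_zero_of_smul (hV x hx hgx).2 hsmul

/-- The lines through a general point of a surface covered by lines lie in the pencil of tangent
directions, so they are the common roots of polynomials in the slope of the pencil. -/
theorem exists_isRulingField_or_two_lines [IsAlgClosed k] [CharZero k] {F : MvPolynomial (Fin 3) k}
    (hF : Irreducible F)
    (hruled : ∀ x, eval x F = 0 → ∃ v : Fin 3 → k, v ≠ 0 ∧ restrictToLine x v F = 0) :
    (∃ V : Fin 3 → MvPolynomial (Fin 3) k, IsRulingField F V) ∨
    (∃ g : MvPolynomial (Fin 3) k, ¬ F ∣ g ∧ ∀ x, eval x F = 0 → eval x g ≠ 0 →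
      ∃ v w : Fin 3 → k, v ⨯₃ w ≠ 0 ∧ restrictToLine x v F = 0 ∧ restrictToLine x w F = 0) := by
  obtain ⟨j, hj⟩ := exists_not_dvd_pderiv hF
  obtain ⟨e, e', he⟩ := exists_cross_single_eq_single (k := k) j
  have hn (x : Fin 3 → k) (hx : eval x (pderiv j F) ≠ 0) :
      (eval x ∘ grad F) ⬝ᵥ (e ⨯₃ e') ≠ 0 := by
    simpa [he, grad] using hx
  have hdvd (d) (hd : ¬ F ∣ d) : ¬ F ∣ d * pderiv j F := fun h =>
    (hF.prime.dvd_or_dvd h).elim hd hj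
  have hmap (x : Fin 3 → k) (v : Fin 3 → k) : eval x ∘ (C ∘ v : Fin 3 → MvPolynomial _ k) = v := by
    funext i; simp
  rcases generic_common_roots_on_hypersurface hF
    (Ideal.span (Set.range (pencilRestriction F e e').coeff)) with
    ⟨d, hd, H⟩ | ⟨p₀, p₁, d, hd, H⟩ | ⟨d, hd, H⟩
  · refine .inl ⟨_, .of_generic hF (hdvd d hd) (V := grad F ⨯₃ (C ∘ e)) fun x hx hgx => ?_⟩
    rw [map_mul, mul_ne_zero_iff] at hgx
    have hnx := hn x hgx.2
    rw [map_cross, hmap]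
    have hne : (eval x ∘ grad F) ⨯₃ e ≠ 0 := by
      intro h
      apply hnx
      rw [triple_product_permutation, triple_product_permutation, h, dotProduct_zero]
    obtain ⟨v, hv, hline⟩ := hruled x hx
    obtain ⟨α, c, hc⟩ | ⟨c, hc⟩ := exists_cross_eq_smul hv (dotProduct_grad_eq_zero hline) hnx
    · exact absurd (span_coeff_pencilRestriction_le_ker_iff.2
        (restrictToLine_eq_zero_of_smul hline hc)) (H x hx hgx.1 α)
    · exact ⟨hne, restrictToLine_eq_zero_of_smul hline hc⟩
  · refine .inl ⟨_, .of_generic hF (hdvd d hd)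
      (V := grad F ⨯₃ (p₁ • (C ∘ e') + p₀ • (C ∘ e))) fun x hx hgx => ?_⟩
    rw [map_mul, mul_ne_zero_iff] at hgx
    obtain ⟨hp₁, hroot⟩ := H x hx hgx.1
    have hV : eval x ∘ (grad F ⨯₃ (p₁ • (C ∘ e') + p₀ • (C ∘ e))) =
        eval x p₁ • ((eval x ∘ grad F) ⨯₃ (e' + (eval x p₀ / eval x p₁) • e)) := by
      rw [map_cross, ← map_smul, smul_add, smul_smul, mul_div_cancel₀ _ hp₁]
      congr 1
      funext i
      simp
    rw [hV]
    exact ⟨smul_ne_zero hp₁ (cross_add_smul_ne_zero (hn x hgx.2) _),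
      restrictToLine_eq_zero_of_smul (span_coeff_pencilRestriction_le_ker_iff.1 hroot) rfl⟩
  · refine .inr ⟨_, hdvd d hd, fun x hx hgx => ?_⟩
    rw [map_mul, mul_ne_zero_iff] at hgx
    obtain ⟨α, β, hαβ, hα, hβ⟩ := H x hx hgx.1
    exact ⟨_, _, cross_cross_cross_add_smul_ne_zero (hn x hgx.2) hαβ,
      span_coeff_pencilRestriction_le_ker_iff.1 hα, span_coeff_pencilRestriction_le_ker_iff.1 hβ⟩

end Directions

section LinearForm

open MvPolynomial Matrix

variable {R σ : Type*} [CommRing R]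

theorem eval_grad_mul_of_eval_eq_zero {F : MvPolynomial σ R} {y : σ → R} (hy : eval y F = 0)
    (H : MvPolynomial σ R) : eval y ∘ grad (F * H) = eval y H • (eval y ∘ grad F) := by
  funext i
  simp [grad, hy]

variable [Fintype σ]

/-- The linear form `y ↦ c ⬝ᵥ (y - x)`, vanishing on the hyperplane through `x` normal to `c`. -/
def linearForm (c x : σ → R) : MvPolynomial σ R :=
  (C ∘ c) ⬝ᵥ (X - C ∘ x)

theorem eval_linearForm (c x y : σ → R) : eval y (linearForm c x) = c ⬝ᵥ (y - x) := by
  simp [linearForm, dotProduct]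

theorem eval_grad_linearForm (c x y : σ → R) : eval y ∘ grad (linearForm c x) = c := by
  classical
  funext i
  simp [grad, linearForm, dotProduct, Pi.single_apply]

theorem exists_eq_smul_grad_of_dvd_linearForm {F : MvPolynomial σ R} {c x : σ → R}
    (h : F ∣ linearForm c x) (y : σ → R) (hy : eval y F = 0) :
    ∃ a : R, c = a • (eval y ∘ grad F) := by
  obtain ⟨H, hH⟩ := h
  refine ⟨eval y H, ?_⟩
  rw [← eval_grad_mul_of_eval_eq_zero hy, ← hH, eval_grad_linearForm]

variable {k : Type*} [Field k]

theorem exists_not_dvd_linearForm {F : MvPolynomial (Fin 3) k} {x v : Fin 3 → k} (hv : v ≠ 0)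
    (hx : eval x F = 0) : ∃ c, c ⬝ᵥ v = 0 ∧ ¬ F ∣ linearForm c x := by
  by_contra! hdvd
  obtain ⟨j, hj⟩ := Function.ne_iff.1 hv
  obtain ⟨e, e', he⟩ := exists_cross_single_eq_single (k := k) j
  obtain ⟨a, ha⟩ := exists_eq_smul_grad_of_dvd_linearForm
    (hdvd (v ⨯₃ e) (by rw [dotProduct_comm, dot_self_cross])) x hx
  obtain ⟨a', ha'⟩ := exists_eq_smul_grad_of_dvd_linearForm
    (hdvd (v ⨯₃ e') (by rw [dotProduct_comm, dot_self_cross])) x hx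
  have hcross : (v ⨯₃ e) ⨯₃ (v ⨯₃ e') = 0 := by
    rw [ha, ha']
    simp [cross_self]
  rw [cross_cross_cross_self, he, dotProduct_single_one] at hcross
  exact smul_ne_zero hj hv hcross

theorem restrictToLine_eq_zero_of_dvd_linearForm [Infinite k] {F : MvPolynomial σ k} {c x : σ → k}
    (hc : c ≠ 0) (hF : F ∣ linearForm c x) {e : σ → k} (he : c ⬝ᵥ e = 0) {y : σ → k}
    (hy : eval y F = 0) : restrictToLine y e F = 0 := by
  obtain ⟨H, hH⟩ := hF
  have hline : restrictToLine y e (linearForm c x) = 0 := by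
    refine Polynomial.funext fun τ => ?_
    have hyx : c ⬝ᵥ (y - x) = 0 := by rw [← eval_linearForm, hH, map_mul, hy, zero_mul]
    rw [eval_restrictToLine, eval_linearForm, add_sub_right_comm, dotProduct_add, hyx,
      dotProduct_smul, he, smul_zero, add_zero, Polynomial.eval_zero]
  rw [hH, map_mul, mul_eq_zero] at hline
  refine hline.resolve_right fun h => hc ?_
  have hHy : eval y H = 0 := by
    simpa [eval_restrictToLine] using congrArg (Polynomial.eval 0) h
  rw [← eval_grad_linearForm c x y, hH, eval_grad_mul_of_eval_eq_zero hy, hHy, zero_smul]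

theorem IsRulingField.of_dvd_linearForm [Infinite k] {F : MvPolynomial (Fin 3) k}
    (hF : Irreducible F) {c x e : Fin 3 → k} (hc : c ≠ 0) (h : F ∣ linearForm c x) (he₀ : e ≠ 0)
    (he : c ⬝ᵥ e = 0) : IsRulingField F (C ∘ e) where
  exists_not_dvd := by
    obtain ⟨i, hi⟩ := Function.ne_iff.1 he₀
    exact ⟨i, fun hdvd => hF.not_isUnit (isUnit_of_dvd_unit hdvd ((IsUnit.mk0 _ hi).map C))⟩
  restrictToLine_eq_zero y hy := by
    have hC : eval y ∘ (C ∘ e) = e := funext fun i => eval_C _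
    rw [hC]
    exact restrictToLine_eq_zero_of_dvd_linearForm hc h he hy

end LinearForm

section RulingField

open MvPolynomial

variable {k : Type*} [Field k]

theorem HasValueAt.unique {P : Fin 3 → FunctionField k} {z : Fin 2 → k} {x y : Fin 3 → k}
    (hx : HasValueAt P z x) (hy : HasValueAt P z y) : x = y := by
  funext i
  have h := sub_mem (hasValueAt_iff.1 hx i) (hasValueAt_iff.1 hy i)
  rw [Prod.mk_sub_mk, sub_self] at h
  exact sub_eq_zero.1 (eq_zero_of_mem_valueSubalgebra h)

theorem Parametrizes.exists_eval_ne_zero [IsAlgClosed k] {F : MvPolynomial (Fin 3) k}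
    (hF : Irreducible F) {P : Fin 3 → FunctionField k} (hP : Parametrizes P {x | eval x F = 0})
    {h : MvPolynomial (Fin 2) k} (hh : h ≠ 0) {f : MvPolynomial (Fin 3) k} (hf : ¬ F ∣ f) :
    ∃ z x, eval z h ≠ 0 ∧ HasValueAt P z x ∧ eval x f ≠ 0 := by
  by_contra! hcon
  rw [← Ideal.mem_span_singleton, ← (parametrizes_iff_ker_eq_span hF).1 hP] at hf
  exact hf (aeval_eq_zero_of_forall_hasValueAt hh hcon)

theorem exists_clear_denominators {σ ι A : Type*} [Finite ι] [CommRing A] [Algebra k A]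
    (a : σ → A) (b : A) (G : ι → MvPolynomial σ k) :
    ∃ (N : ℕ) (W : ι → A), ∀ φ : A →ₐ[k] k, φ b ≠ 0 →
      ∀ i, φ (W i) = φ b ^ N * eval (fun j => φ (a j) / φ b) (G i) := by
  let b' : Submonoid.powers b := ⟨b, Submonoid.mem_powers b⟩
  obtain ⟨⟨_, N, rfl⟩, h⟩ := IsLocalization.exist_integer_multiples_of_finite (Submonoid.powers b)
    fun i => aeval (fun j => IsLocalization.mk' (Localization.Away b) (a j) b') (G i)
  choose W hW using h
  refine ⟨N, W, fun φ hφ i => ?_⟩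
  have hunit (y : Submonoid.powers b) : IsUnit (φ y) := by
    obtain ⟨_, n, rfl⟩ := y
    simpa using (isUnit_iff_ne_zero.2 hφ).pow n
  let ψ : Localization.Away b →ₐ[k] k := IsLocalization.liftAlgHom (f := φ) hunit
  have hψ (z : A) : ψ (algebraMap A _ z) = φ z := IsLocalization.lift_eq _ _
  have hmk (z : A) : ψ (IsLocalization.mk' _ z b') = φ z / φ b := by
    rw [eq_div_iff hφ, ← hψ z, ← hψ b, ← map_mul, IsLocalization.mk'_spec _ z b']
  have h := congrArg ψ (hW i)
  rw [hψ, Algebra.smul_def, map_mul, hψ, comp_aeval_apply] at h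
  simpa [hmk, aeval_eq_eval] using h

namespace RuledForm

/-- The value of the parametrization at the parameters `u, t`, meaningful where `q(u) ≠ 0`. -/
def pt (D : RuledForm k) (u t : k) : Fin 3 → k :=
  fun i => ((D.r i).eval u + t * (D.p i).eval u) / D.q.eval u

theorem hasValueAt_toMap (D : RuledForm k) {u t : k} (hu : D.q.eval u ≠ 0) :
    HasValueAt D.toMap ![u, t] (D.pt u t) := by
  have hs : (paramS k, u) ∈ valueSubalgebra ![u, t] := by
    simpa [paramS] using mk_algebraMap_mem_valueSubalgebra ![u, t] (X 0)
  have ht : (paramT k, t) ∈ valueSubalgebra ![u, t] := by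
    simpa [paramT] using mk_algebraMap_mem_valueSubalgebra ![u, t] (X 1)
  exact hasValueAt_iff.2 fun i => mk_div_mem_valueSubalgebra
    (add_mem (mk_aeval_mem_valueSubalgebra hs _) (mul_mem ht (mk_aeval_mem_valueSubalgebra hs _)))
    (mk_aeval_mem_valueSubalgebra hs _) hu

theorem exists_pt_eq_add_smul (D : RuledForm k) {u : k} (hq : D.q.eval u ≠ 0)
    (hp : ∃ i, (D.p i).eval u ≠ 0) :
    ∃ c v : Fin 3 → k, v ≠ 0 ∧ ∀ t, D.pt u t = c + t • v := by
  obtain ⟨i, hi⟩ := hp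
  refine ⟨D.pt u 0, fun i => (D.p i).eval u / D.q.eval u,
    fun h => div_ne_zero hi hq (congrFun h i), fun t => funext fun i => ?_⟩
  simp [pt, add_div, mul_div_assoc]

theorem isLine_range_pt (D : RuledForm k) {u : k} (hq : D.q.eval u ≠ 0)
    (hp : ∃ i, (D.p i).eval u ≠ 0) : IsLine (Set.range (D.pt u)) := by
  obtain ⟨c, v, hv, h⟩ := D.exists_pt_eq_add_smul hq hp
  exact ⟨c, v, hv, congrArg Set.range (funext h)⟩

theorem parametrizes_toMap_of_pt [IsAlgClosed k] (D : RuledForm k) {F : MvPolynomial (Fin 3) k}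
    (hF : Irreducible F) {h : Polynomial k} (hh : h ≠ 0)
    (hD : ∀ u t, h.eval u ≠ 0 → D.q.eval u ≠ 0 → eval (D.pt u t) F = 0) {u u' t' : k}
    (hq : D.q.eval u ≠ 0) (hp : ∃ i, (D.p i).eval u ≠ 0) (hq' : D.q.eval u' ≠ 0)
    (hpt : D.pt u' t' ∉ Set.range (D.pt u)) : Parametrizes D.toMap {x | eval x F = 0} := by
  refine parametrizes_of_isLine_subset_image hF ?_ (D.isLine_range_pt hq hp) ?_
    fun hsub => hpt (hsub ⟨_, D.hasValueAt_toMap hq'⟩)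
  · have hhq : (h * D.q).toMvPolynomial (0 : Fin 2) ≠ 0 :=
      (map_ne_zero_iff _ (Polynomial.toMvPolynomial_injective 0)).2 (mul_ne_zero hh D.q_ne_zero)
    refine aeval_eq_zero_of_forall_hasValueAt hhq fun z y hz hy => ?_
    obtain ⟨hhz, hq⟩ : h.eval (z 0) ≠ 0 ∧ D.q.eval (z 0) ≠ 0 := by
      simpa [not_or] using hz
    have hz : z = ![z 0, z 1] := by ext i; fin_cases i <;> rfl
    rw [hz] at hy
    rw [hy.unique (D.hasValueAt_toMap hq)]
    exact hD _ _ hhz hq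
  · rintro _ ⟨t, rfl⟩
    exact ⟨_, D.hasValueAt_toMap hq⟩

end RuledForm

theorem exists_ruledForm_pt_eq (a : Fin 3 → MvPolynomial (Fin 2) k) {b : MvPolynomial (Fin 2) k}
    (V : Fin 3 → MvPolynomial (Fin 3) k) {z : Fin 2 → k} (hz : eval z b ≠ 0) (w : Fin 2 → k) :
    ∃ D : RuledForm k, D.q = restrictToLine z w b ∧ ∀ u x, D.q.eval u ≠ 0 →
      (x = fun i => eval (z + u • w) (a i) / eval (z + u • w) b) →
      ∃ c ≠ 0, (∀ i, (D.p i).eval u = c * eval x (V i)) ∧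
        ∀ t, D.pt u t = x + (t * c / D.q.eval u) • (eval x ∘ V) := by
  have hq : restrictToLine z w b ≠ 0 := by
    intro h
    apply hz
    rw [← add_zero z, ← zero_smul k w, ← eval_restrictToLine, h, Polynomial.eval_zero]
  obtain ⟨N, W, hW⟩ := exists_clear_denominators (fun i => restrictToLine z w (a i))
    (restrictToLine z w b) V
  refine ⟨⟨fun i => restrictToLine z w (a i), W, restrictToLine z w b, hq⟩, rfl,
    fun u x hu hx => ⟨_, pow_ne_zero N hu, ?_⟩⟩
  have hWu (i : Fin 3) : (W i).eval u = (restrictToLine z w b).eval u ^ N * eval x (V i) := by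
    have h := hW (Polynomial.aeval u) (by simpa using hu) i
    simp only [Polynomial.coe_aeval_eq_eval, eval_restrictToLine] at h
    rw [h, hx, eval_restrictToLine]
  refine ⟨hWu, fun t => funext fun i => ?_⟩
  simp only [RuledForm.pt, hWu, Pi.add_apply, Pi.smul_apply, Function.comp_apply, smul_eq_mul]
  rw [congrFun hx i, eval_restrictToLine, eval_restrictToLine]
  ring

theorem IsRulingField.exists_ruledForm [IsAlgClosed k] {F : MvPolynomial (Fin 3) k}
    (hF : Irreducible F) {P : Fin 3 → FunctionField k} (hP : Parametrizes P {x | eval x F = 0})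
    {V : Fin 3 → MvPolynomial (Fin 3) k} (hV : IsRulingField F V) :
    ∃ D : RuledForm k, Parametrizes D.toMap {x | eval x F = 0} ∧ ∃ i, D.p i ≠ 0 := by
  obtain ⟨a, b, hb, hab⟩ := exists_common_denominator P
  have hvalue {z} (hz : eval z b ≠ 0) : HasValueAt P z (fun i => eval z (a i) / eval z b) :=
    fun i => ⟨a i, b, hz, hab i, rfl⟩
  obtain ⟨i, hi⟩ := hV.exists_not_dvd
  obtain ⟨z, x, hz, hzx, hx⟩ := hP.exists_eval_ne_zero hF hb hi
  obtain ⟨c, hc, hcF⟩ := exists_not_dvd_linearForm (v := eval x ∘ V) (fun h => hx (congrFun h i))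
    (hP.image_subset ⟨z, hzx⟩)
  obtain ⟨z', x', hz', hzx', hx'⟩ := hP.exists_eval_ne_zero hF hb hcF
  obtain ⟨D, hDq, hD⟩ := exists_ruledForm_pt_eq a V hz (z' - z)
  have hq (u : k) : D.q.eval u = eval (z + u • (z' - z)) b := by rw [hDq, eval_restrictToLine]
  have hq₀ : D.q.eval 0 ≠ 0 := by rwa [hq, zero_smul, add_zero]
  have hq₁ : D.q.eval 1 ≠ 0 := by rwa [hq, one_smul, add_sub_cancel]
  obtain ⟨c₀, hc₀, hp, hpt₀⟩ := hD 0 x hq₀ (by simpa using hzx.unique (hvalue hz))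
  obtain ⟨c₁, -, -, hpt₁⟩ := hD 1 x' hq₁ (by simpa using hzx'.unique (hvalue hz'))
  have hpi : (D.p i).eval 0 ≠ 0 := by
    rw [hp]
    exact mul_ne_zero hc₀ hx
  refine ⟨D, D.parametrizes_toMap_of_pt hF one_ne_zero (fun u t _ hu => ?_) hq₀ ⟨i, hpi⟩ hq₁
    (t' := 0) ?_, i, fun h => hpi (by rw [h, Polynomial.eval_zero])⟩
  · obtain ⟨c, -, -, hpt⟩ := hD u _ hu rfl
    rw [hpt, ← eval_restrictToLine, hV.restrictToLine_eq_zero, Polynomial.eval_zero]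
    exact hP.image_subset ⟨_, hvalue (by rwa [← hq])⟩
  · rintro ⟨t, ht⟩
    rw [hpt₀, hpt₁, zero_mul, zero_div, zero_smul, add_zero] at ht
    rw [eval_linearForm, ← ht, add_sub_cancel_left, dotProduct_smul, hc, smul_zero] at hx'
    exact hx' rfl

end RulingField

section Hessian

open MvPolynomial Matrix

variable {R σ : Type*} [CommRing R]

theorem pderiv_comm (i j : σ) (F : MvPolynomial σ R) :
    pderiv i (pderiv j F) = pderiv j (pderiv i F) := by
  ext m
  obtain rfl | hij := eq_or_ne i j
  · rfl
  simp only [coeff_pderiv, Finsupp.add_apply, Finsupp.single_eq_of_ne hij,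
    Finsupp.single_eq_of_ne hij.symm, add_zero, add_right_comm m]
  ring

/-- The matrix of second partial derivatives of a polynomial. -/
def hessian (F : MvPolynomial σ R) : Matrix σ σ (MvPolynomial σ R) :=
  .of fun i => grad (grad F i)

theorem isSymm_hessian (F : MvPolynomial σ R) : (hessian F).IsSymm :=
  .ext fun i j => pderiv_comm i j F

variable [Fintype σ]

theorem derivative_restrictToLine_grad (c v : σ → R) (F : MvPolynomial σ R) :
    Polynomial.derivative ∘ restrictToLine c v ∘ grad F =
      (hessian F).map (restrictToLine c v) *ᵥ (Polynomial.C ∘ v) := by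
  funext i
  exact (derivative_restrictToLine c v (grad F i)).trans (dotProduct_comm _ _)

theorem dotProduct_restrictToLine_grad_eq_zero {F : MvPolynomial σ R} {x w : σ → R}
    (h : restrictToLine x w F = 0) :
    (Polynomial.C ∘ w) ⬝ᵥ (restrictToLine x w ∘ grad F) = 0 := by
  rw [← derivative_restrictToLine, h, Polynomial.derivative_zero]

theorem dotProduct_derivative_restrictToLine_grad_eq_zero {F : MvPolynomial σ R} {x w : σ → R}
    (h : restrictToLine x w F = 0) :
    (Polynomial.C ∘ w) ⬝ᵥ (Polynomial.derivative ∘ restrictToLine x w ∘ grad F) = 0 := by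
  have h' := congrArg Polynomial.derivative (dotProduct_restrictToLine_grad_eq_zero h)
  simpa [dotProduct] using h'

theorem dotProduct_hessian_mulVec_eq_zero {F : MvPolynomial σ R} {x w : σ → R}
    (h : restrictToLine x w F = 0) : w ⬝ᵥ ((hessian F).map (eval x) *ᵥ w) = 0 := by
  have h' := congrArg (Polynomial.eval 0) (dotProduct_derivative_restrictToLine_grad_eq_zero h)
  rw [derivative_restrictToLine_grad] at h'
  simpa [dotProduct, mulVec, Polynomial.eval_finsetSum, eval_restrictToLine] using h'

end Hessian

section SecondDirection

open MvPolynomial Matrix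

variable {k : Type*} [Field k]

theorem exists_cross_add_smul_eq_smul {n v w e : Fin 3 → k} (hn : n ≠ 0) (hv : v ⬝ᵥ n = 0)
    (hw : w ⬝ᵥ n = 0) (hvw : v ⨯₃ w ≠ 0) : ∃ θ a : k, n ⨯₃ e + θ • w = a • v := by
  obtain ⟨c, hc⟩ : ∃ c : k, v ⨯₃ w = c • n := by
    refine exists_eq_smul_of_cross_eq_zero hn ?_
    rw [cross_cross_eq_smul_sub_smul', dotProduct_comm, hw, hv, zero_smul, zero_smul, sub_zero]
  have hc₀ : c ≠ 0 := by
    rintro rfl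
    exact hvw (by rw [hc, zero_smul])
  have hcross : c • (n ⨯₃ e) = (v ⬝ᵥ e) • w - (e ⬝ᵥ w) • v := by
    have h := cross_cross_eq_smul_sub_smul' e v w
    rw [hc, map_smul, ← cross_anticomm, smul_neg] at h
    rw [← neg_neg (c • _), h, neg_sub]
  refine ⟨-(c⁻¹ * (v ⬝ᵥ e)), -(c⁻¹ * (e ⬝ᵥ w)), ?_⟩
  rw [← inv_smul_smul₀ hc₀ (n ⨯₃ e), hcross]
  module

theorem smul_sub_smul_eq_smul_of_isotropic {σ : Type*} [Fintype σ] {H : Matrix σ σ k}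
    (hH : H.IsSymm) {u v w : σ → k} (hv : v ⬝ᵥ (H *ᵥ v) = 0) (hw : w ⬝ᵥ (H *ᵥ w) = 0) {θ a : k}
    (huv : u + θ • w = a • v) :
    (2 * (u ⬝ᵥ (H *ᵥ w))) • u - (u ⬝ᵥ (H *ᵥ u)) • w = (2 * (u ⬝ᵥ (H *ᵥ w)) * a) • v := by
  have hwu : w ⬝ᵥ (H *ᵥ u) = u ⬝ᵥ (H *ᵥ w) := by
    rw [dotProduct_mulVec, ← mulVec_transpose, hH.eq, dotProduct_comm]
  have hiso : u ⬝ᵥ (H *ᵥ u) + 2 * θ * (u ⬝ᵥ (H *ᵥ w)) = 0 := by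
    have h : (u + θ • w) ⬝ᵥ (H *ᵥ (u + θ • w)) = 0 := by
      rw [huv, mulVec_smul, smul_dotProduct, dotProduct_smul, hv, smul_zero, smul_zero]
    simp only [mulVec_add, mulVec_smul, add_dotProduct, dotProduct_add, smul_dotProduct,
      dotProduct_smul, smul_eq_mul, hwu, hw, mul_zero, add_zero] at h
    linear_combination h
  rw [mul_smul _ a v, ← huv, eq_neg_of_add_eq_zero_left hiso]
  module

/-- Given a direction `w`, tangent and isotropic for the Hessian at a point of the surface `F = 0`,
this is the other tangent isotropic direction, written in the basis `u = ∇F ⨯₃ e`, `w` of the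
tangent plane: the isotropy equation of `u + θ • w` is linear in `θ`. -/
def secondIsotropicDirection (F : MvPolynomial (Fin 3) k) (e w : Fin 3 → k) :
    Fin 3 → MvPolynomial (Fin 3) k :=
  let u := grad F ⨯₃ (C ∘ e)
  (2 * (u ⬝ᵥ (hessian F *ᵥ (C ∘ w)))) • u - (u ⬝ᵥ (hessian F *ᵥ u)) • (C ∘ w)

theorem eval_secondIsotropicDirection (F : MvPolynomial (Fin 3) k) (e w x : Fin 3 → k) :
    let u := (eval x ∘ grad F) ⨯₃ e
    let H := (hessian F).map (eval x)
    eval x ∘ secondIsotropicDirection F e w =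
      (2 * (u ⬝ᵥ (H *ᵥ w))) • u - (u ⬝ᵥ (H *ᵥ u)) • w := by
  have hC (a : Fin 3 → k) : eval x ∘ (C ∘ a : Fin 3 → MvPolynomial _ k) = a := by
    funext i; simp
  have hu : eval x ∘ (grad F ⨯₃ (C ∘ e)) = (eval x ∘ grad F) ⨯₃ e := by rw [map_cross, hC]
  have hH (a : Fin 3 → MvPolynomial (Fin 3) k) :
      eval x ∘ (hessian F *ᵥ a) = (hessian F).map (eval x) *ᵥ (eval x ∘ a) :=
    funext fun i => RingHom.map_mulVec _ _ _ i
  funext i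
  simp only [secondIsotropicDirection, Function.comp_apply, Pi.sub_apply, Pi.smul_apply,
    smul_eq_mul, map_sub, map_mul, RingHom.map_dotProduct, map_ofNat, hH, hu, hC, eval_C]
  rw [← hu]
  rfl

theorem restrictToLine_secondIsotropicDirection_eq_zero {F : MvPolynomial (Fin 3) k}
    {x v w : Fin 3 → k} (hn : eval x ∘ grad F ≠ 0) (hvw : v ⨯₃ w ≠ 0)
    (hv : restrictToLine x v F = 0) (hw : restrictToLine x w F = 0) (e : Fin 3 → k) :
    restrictToLine x (eval x ∘ secondIsotropicDirection F e w) F = 0 := by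
  obtain ⟨θ, a, huv⟩ := exists_cross_add_smul_eq_smul (e := e) hn (dotProduct_grad_eq_zero hv)
    (dotProduct_grad_eq_zero hw) hvw
  have hsymm : ((hessian F).map (eval x)).IsSymm := (isSymm_hessian F).map _
  exact restrictToLine_eq_zero_of_smul hv <| (eval_secondIsotropicDirection F e w x).trans <|
    smul_sub_smul_eq_smul_of_isotropic hsymm (dotProduct_hessian_mulVec_eq_zero hv)
      (dotProduct_hessian_mulVec_eq_zero hw) huv

end SecondDirection

section ConstantDirection

open MvPolynomial Matrix

variable {k : Type*} [Field k]

theorem exists_eq_C_mul_of_wronskian_eq_zero [CharZero k] {f g : Polynomial k} (hg : g ≠ 0)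
    (h : Polynomial.wronskian f g = 0) : ∃ c : k, f = Polynomial.C c * g := by
  classical
  set d := GCDMonoid.gcd f g
  obtain ⟨f', hf⟩ : d ∣ f := GCDMonoid.gcd_dvd_left f g
  obtain ⟨g', hg'⟩ : d ∣ g := GCDMonoid.gcd_dvd_right f g
  have hd : d ≠ 0 := left_ne_zero_of_mul (hg' ▸ hg)
  have hcop : IsCoprime f' g' := by
    have hdiv : IsCoprime (f / d) (g / d) := isCoprime_div_gcd_div_gcd hg
    rwa [hf, hg', mul_div_cancel_left₀ _ hd, mul_div_cancel_left₀ _ hd] at hdiv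
  have hW : Polynomial.wronskian f' g' = 0 := by
    have hmul : d ^ 2 * Polynomial.wronskian f' g' = 0 := by
      rw [← h, hf, hg', Polynomial.wronskian, Polynomial.wronskian, Polynomial.derivative_mul,
        Polynomial.derivative_mul]
      ring
    exact (mul_eq_zero.1 hmul).resolve_left (pow_ne_zero 2 hd)
  obtain ⟨hf'₀, hg'₀⟩ := hcop.wronskian_eq_zero_iff.1 hW
  rw [Polynomial.eq_C_of_derivative_eq_zero hf'₀] at hf
  rw [Polynomial.eq_C_of_derivative_eq_zero hg'₀] at hg'
  have hb : g'.coeff 0 ≠ 0 := fun hb => hg (by rw [hg', hb, Polynomial.C_0, mul_zero])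
  refine ⟨f'.coeff 0 / g'.coeff 0, ?_⟩
  rw [hf, hg', mul_left_comm, ← Polynomial.C_mul, div_mul_cancel₀ _ hb]

theorem exists_eq_smul_of_cross_derivative_eq_zero [CharZero k] {n : Fin 3 → Polynomial k}
    (h : n ⨯₃ (Polynomial.derivative ∘ n) = 0) :
    ∃ (f : Polynomial k) (c : Fin 3 → k), n = f • (Polynomial.C ∘ c) := by
  by_cases hn : n = 0
  · exact ⟨0, 0, by rw [hn, zero_smul]⟩
  obtain ⟨j, hj⟩ := Function.ne_iff.1 hn
  have hW (i : Fin 3) : Polynomial.wronskian (n i) (n j) = 0 := by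
    have h₀ : n 1 * (n 2).derivative - n 2 * (n 1).derivative = 0 := congrFun h 0
    have h₁ : n 2 * (n 0).derivative - n 0 * (n 2).derivative = 0 := congrFun h 1
    have h₂ : n 0 * (n 1).derivative - n 1 * (n 0).derivative = 0 := congrFun h 2
    rw [Polynomial.wronskian]
    fin_cases i <;> fin_cases j <;> grind
  choose c hc using fun i => exists_eq_C_mul_of_wronskian_eq_zero hj (hW i)
  exact ⟨n j, c, funext fun i => (hc i).trans (mul_comm _ _)⟩

theorem cross_eq_zero_of_dotProduct_eq_zero {R : Type*} [CommRing R] [IsDomain R]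
    {a b e w : Fin 3 → R} (ha : w ⬝ᵥ a = 0) (hb : w ⬝ᵥ b = 0) (he : e ⬝ᵥ w ≠ 0)
    (h : e ⬝ᵥ (a ⨯₃ b) = 0) : a ⨯₃ b = 0 := by
  have hw : w ⨯₃ (a ⨯₃ b) = 0 := by
    rw [cross_cross_eq_smul_sub_smul', hb, dotProduct_comm a, ha, zero_smul, zero_smul, sub_zero]
  have hew := cross_cross_eq_smul_sub_smul' e w (a ⨯₃ b)
  rw [hw, map_zero, h, zero_smul, zero_sub, zero_eq_neg, dotProduct_comm] at hew
  exact (smul_eq_zero.1 hew).resolve_left he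

end ConstantDirection

section TransversalLines

open MvPolynomial Matrix

variable {k : Type*} [Field k]

theorem restrictToLine_add_smul_self_eq_zero [Infinite k] {σ : Type*} {F : MvPolynomial σ k}
    {x w : σ → k} (h : restrictToLine x w F = 0) (s : k) :
    restrictToLine (x + s • w) w F = 0 :=
  Polynomial.funext fun τ => by
    rw [eval_restrictToLine, add_assoc, ← add_smul, ← eval_restrictToLine, h]
    simp only [Polynomial.eval_zero]

theorem dvd_of_transversal_lines [Infinite k] {F G : MvPolynomial (Fin 3) k}
    (hF : Irreducible F) {x w : Fin 3 → k} {h : Polynomial k} (hh : h ≠ 0)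
    (hlines : ∀ s, h.eval s ≠ 0 → ∃ v, v ⨯₃ w ≠ 0 ∧
      restrictToLine (x + s • w) v F = 0 ∧ restrictToLine (x + s • w) v G = 0) : F ∣ G := by
  choose! v hvw hvF hvG using hlines
  let L (s : k) : Set (Fin 3 → k) := Set.range fun τ : k => x + s • w + τ • v s
  have hinj : Set.InjOn L {s | h.eval s ≠ 0} := fun s hs s' _ hss' => by
    obtain ⟨τ, hτ⟩ : x + s' • w ∈ L s := hss' ▸ ⟨0, by simp⟩
    have hdir : τ • v s = (s' - s) • w := by
      rw [sub_smul, eq_sub_iff_add_eq', ← add_right_inj x, ← add_assoc]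
      exact hτ
    have hcross : (s' - s) • (v s ⨯₃ w) = 0 := by
      rw [← map_smul, ← hdir, map_smul, cross_self, smul_zero]
    exact (sub_eq_zero.1 ((smul_eq_zero.1 hcross).resolve_right (hvw s hs))).symm
  refine dvd_of_infinite_setOf_isLine hF
    (((Polynomial.finite_setOfPred_isRoot hh).infinite_compl.image hinj).mono ?_)
  rintro _ ⟨s, hs, rfl⟩
  refine ⟨⟨_, v s, fun hv => hvw s hs (by rw [hv, map_zero, LinearMap.zero_apply]), rfl⟩, ?_⟩
  rintro _ ⟨τ, rfl⟩
  constructor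
  · rw [← eval_restrictToLine, hvF s hs, Polynomial.eval_zero]
  · rw [← eval_restrictToLine, hvG s hs, Polynomial.eval_zero]

theorem exists_isRulingField_of_cross_derivative_eq_zero [CharZero k] {F : MvPolynomial (Fin 3) k}
    (hF : Irreducible F) {x w : Fin 3 → k} (hw : restrictToLine x w F = 0) {h : Polynomial k}
    (hh : h ≠ 0) (hlines : ∀ s, h.eval s ≠ 0 → eval (x + s • w) ∘ grad F ≠ 0 ∧
      ∃ v, v ⨯₃ w ≠ 0 ∧ restrictToLine (x + s • w) v F = 0)
    (hn : (restrictToLine x w ∘ grad F) ⨯₃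
      (Polynomial.derivative ∘ restrictToLine x w ∘ grad F) = 0) :
    ∃ V, IsRulingField F V := by
  obtain ⟨f, c, hfc⟩ := exists_eq_smul_of_cross_derivative_eq_zero hn
  have hgrad (s : k) : eval (x + s • w) ∘ grad F = f.eval s • c := funext fun i => by
    simpa [eval_restrictToLine] using congrArg (Polynomial.eval s) (congrFun hfc i)
  have horth {s : k} {v : Fin 3 → k} (hs : h.eval s ≠ 0)
      (hv : restrictToLine (x + s • w) v F = 0) : c ⬝ᵥ v = 0 := by
    have hdot := dotProduct_grad_eq_zero hv
    rw [hgrad, dotProduct_smul, smul_eq_zero, dotProduct_comm] at hdot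
    refine hdot.resolve_left fun hf => (hlines s hs).1 ?_
    rw [hgrad, hf, zero_smul]
  obtain ⟨s, hs⟩ := (Polynomial.finite_setOfPred_isRoot hh).infinite_compl.nonempty
  obtain ⟨hgs, v, hvw, -⟩ := hlines s hs
  have hcw : c ⬝ᵥ w = 0 := horth hs (restrictToLine_add_smul_self_eq_zero hw s)
  have hdvd : F ∣ linearForm c x := by
    refine dvd_of_transversal_lines (x := x) (w := w) hF hh fun s hs => ?_
    obtain ⟨-, v, hvw, hv⟩ := hlines s hs
    refine ⟨v, hvw, hv, Polynomial.funext fun τ => ?_⟩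
    rw [eval_restrictToLine, eval_linearForm, add_assoc, add_sub_cancel_left, dotProduct_add,
      dotProduct_smul, dotProduct_smul, hcw, horth hs hv]
    simp only [smul_zero, add_zero, Polynomial.eval_zero]
  refine ⟨_, IsRulingField.of_dvd_linearForm hF (e := w) (fun hc => hgs ?_) hdvd
    (fun hw => hvw ?_) hcw⟩
  · rw [hgrad, hc, smul_zero]
  · rw [hw, map_zero]

theorem eval_secondIsotropicDirection_cross [Infinite k] {F : MvPolynomial (Fin 3) k}
    {x w : Fin 3 → k} (hw : restrictToLine x w F = 0) (e : Fin 3 → k) (s : k) :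
    let n := restrictToLine x w ∘ grad F
    (eval (x + s • w) ∘ secondIsotropicDirection F e w) ⨯₃ w =
      (2 * (e ⬝ᵥ w) * ((Polynomial.C ∘ e) ⬝ᵥ (n ⨯₃ (Polynomial.derivative ∘ n))).eval s) •
        (eval (x + s • w) ∘ grad F) := by
  intro n
  have hn : eval (x + s • w) ∘ grad F = Polynomial.eval s ∘ n := by
    funext i
    simp [n, eval_restrictToLine]
  have hH : (hessian F).map (eval (x + s • w)) *ᵥ w =
      Polynomial.eval s ∘ Polynomial.derivative ∘ n := by
    rw [derivative_restrictToLine_grad]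
    funext i
    simp [mulVec, dotProduct, Polynomial.eval_finsetSum, eval_restrictToLine]
  have hz : ((Polynomial.C ∘ e) ⬝ᵥ (n ⨯₃ (Polynomial.derivative ∘ n))).eval s =
      -((eval (x + s • w) ∘ grad F) ⨯₃ e ⬝ᵥ ((hessian F).map (eval (x + s • w)) *ᵥ w)) := by
    rw [hn, hH]
    simp only [vec3_dotProduct, cross_apply, Function.comp_apply, cons_val, Polynomial.eval_add,
      Polynomial.eval_sub, Polynomial.eval_mul, Polynomial.eval_C]
    ring
  rw [hz, eval_secondIsotropicDirection, map_sub, map_smul, map_smul, LinearMap.sub_apply,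
    LinearMap.smul_apply, LinearMap.smul_apply, cross_self, cross_cross_eq_smul_sub_smul,
    dotProduct_comm _ w, dotProduct_grad_eq_zero (restrictToLine_add_smul_self_eq_zero hw s)]
  module

theorem exists_ruledForm_pt_eq_add_smul (x w : Fin 3 → k) (V : Fin 3 → MvPolynomial (Fin 3) k) :
    ∃ D : RuledForm k, D.q = 1 ∧ (∀ s i, (D.p i).eval s = eval (x + s • w) (V i)) ∧
      ∀ s t, D.pt s t = x + s • w + t • (eval (x + s • w) ∘ V) := by
  refine ⟨⟨Polynomial.C ∘ x + (Polynomial.X : Polynomial k) • (Polynomial.C ∘ w),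
    restrictToLine x w ∘ V, 1, one_ne_zero⟩, rfl, fun s i => eval_restrictToLine _ _ (V i) _,
    fun s t => funext fun i => ?_⟩
  simp [RuledForm.pt, eval_restrictToLine, mul_comm s]

theorem exists_ruledForm_of_cross_derivative_ne_zero [IsAlgClosed k] [CharZero k]
    {F : MvPolynomial (Fin 3) k} (hF : Irreducible F) {x w : Fin 3 → k}
    (hw : restrictToLine x w F = 0) {h : Polynomial k} (hh : h ≠ 0)
    (hlines : ∀ s, h.eval s ≠ 0 → eval (x + s • w) ∘ grad F ≠ 0 ∧
      ∃ v, v ⨯₃ w ≠ 0 ∧ restrictToLine (x + s • w) v F = 0)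
    (hn : (restrictToLine x w ∘ grad F) ⨯₃
      (Polynomial.derivative ∘ restrictToLine x w ∘ grad F) ≠ 0) :
    ∃ D : RuledForm k, Parametrizes D.toMap {x | eval x F = 0} ∧ ∃ i, D.p i ≠ 0 := by
  obtain ⟨e, he⟩ : ∃ e : Fin 3 → k, e ⬝ᵥ w ≠ 0 := by
    by_contra! he
    obtain ⟨s, hs⟩ := (Polynomial.finite_setOfPred_isRoot hh).infinite_compl.nonempty
    obtain ⟨-, v, hvw, -⟩ := hlines s hs
    exact hvw (by rw [dotProduct_eq_zero w fun e => by rw [dotProduct_comm, he], map_zero])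
  have hB : (Polynomial.C ∘ e) ⬝ᵥ ((restrictToLine x w ∘ grad F) ⨯₃
      (Polynomial.derivative ∘ restrictToLine x w ∘ grad F)) ≠ 0 := fun hB => by
    refine hn (cross_eq_zero_of_dotProduct_eq_zero (dotProduct_restrictToLine_grad_eq_zero hw)
      (dotProduct_derivative_restrictToLine_grad_eq_zero hw) ?_ hB)
    rwa [← RingHom.map_dotProduct, Polynomial.C_ne_zero]
  obtain ⟨u, hu⟩ := (Polynomial.finite_setOfPred_isRoot (mul_ne_zero hh hB)).infinite_compl.nonempty
  obtain ⟨hhu, hBu⟩ := not_or.1 (Polynomial.root_mul.not.1 hu)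
  obtain ⟨D, hq, hp, hpt⟩ := exists_ruledForm_pt_eq_add_smul x w (secondIsotropicDirection F e w)
  have hcross : (eval (x + u • w) ∘ secondIsotropicDirection F e w) ⨯₃ w ≠ 0 := by
    rw [eval_secondIsotropicDirection_cross hw]
    exact smul_ne_zero (mul_ne_zero (mul_ne_zero two_ne_zero he) hBu) (hlines u hhu).1
  have hV : eval (x + u • w) ∘ secondIsotropicDirection F e w ≠ 0 := fun h =>
    hcross (by rw [h, map_zero, LinearMap.zero_apply])
  obtain ⟨i, hi⟩ := Function.ne_iff.1 hV
  have hpi : (D.p i).eval u ≠ 0 := by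
    rw [hp]
    exact hi
  have hq₀ (s : k) : D.q.eval s ≠ 0 := by simp [hq]
  refine ⟨D, D.parametrizes_toMap_of_pt hF hh (fun s t hs _ => ?_) (hq₀ u) ⟨i, hpi⟩
    (hq₀ (u + 1)) (t' := 0) ?_, i, fun h => hpi (by rw [h, Polynomial.eval_zero])⟩
  · obtain ⟨hgrad, v, hvw, hv⟩ := hlines s hs
    rw [hpt, ← eval_restrictToLine, restrictToLine_secondIsotropicDirection_eq_zero hgrad hvw hv
      (restrictToLine_add_smul_self_eq_zero hw s), Polynomial.eval_zero]
  · rintro ⟨t, ht⟩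
    rw [hpt, hpt, zero_smul, add_zero, add_smul, one_smul, ← add_assoc, add_right_inj] at ht
    have h := congrArg (crossProduct (eval (x + u • w) ∘ secondIsotropicDirection F e w)) ht
    rw [map_smul, cross_self, smul_zero] at h
    exact hcross h.symm

theorem exists_ruledForm_or_isRulingField_of_two_lines [IsAlgClosed k] [CharZero k]
    {F g : MvPolynomial (Fin 3) k} (hF : Irreducible F) (hg : ¬ F ∣ g)
    (hlines : ∀ x, eval x F = 0 → eval x g ≠ 0 →
      ∃ v w : Fin 3 → k, v ⨯₃ w ≠ 0 ∧ restrictToLine x v F = 0 ∧ restrictToLine x w F = 0) :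
    (∃ D : RuledForm k, Parametrizes D.toMap {x | eval x F = 0} ∧ ∃ i, D.p i ≠ 0) ∨
      ∃ V, IsRulingField F V := by
  obtain ⟨j, hj⟩ := exists_not_dvd_pderiv hF
  obtain ⟨x, hx, hgx⟩ : ∃ x, eval x F = 0 ∧ eval x (g * pderiv j F) ≠ 0 := by
    have h := hF.prime.not_dvd_mul hg hj
    rw [dvd_iff_forall_eval_eq_zero hF] at h
    simpa only [not_forall, exists_prop] using h
  rw [map_mul, mul_ne_zero_iff] at hgx
  obtain ⟨w, w', hww', hw, -⟩ := hlines x hx hgx.1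
  have hh : restrictToLine x w (g * pderiv j F) ≠ 0 := fun h => by
    have h₀ := congrArg (Polynomial.eval 0) h
    rw [eval_restrictToLine, zero_smul, add_zero, map_mul, Polynomial.eval_zero] at h₀
    exact mul_ne_zero hgx.1 hgx.2 h₀
  have htransversal (s : k) (hs : (restrictToLine x w (g * pderiv j F)).eval s ≠ 0) :
      eval (x + s • w) ∘ grad F ≠ 0 ∧
        ∃ v, v ⨯₃ w ≠ 0 ∧ restrictToLine (x + s • w) v F = 0 := by
    rw [eval_restrictToLine, map_mul, mul_ne_zero_iff] at hs
    refine ⟨fun h => hs.2 (congrFun h j), ?_⟩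
    obtain ⟨v, v', hvv', hv, hv'⟩ := hlines (x + s • w)
      (by rw [← eval_restrictToLine, hw, Polynomial.eval_zero]) hs.1
    have hw₀ : w ≠ 0 := fun h => hww' (by rw [h, map_zero, LinearMap.zero_apply])
    by_contra! hcon
    have hsmul {v : Fin 3 → k} (hv : restrictToLine (x + s • w) v F = 0) : ∃ a : k, v = a • w := by
      refine exists_eq_smul_of_cross_eq_zero hw₀ ?_
      rw [← cross_anticomm, neg_eq_zero]
      exact not_imp_not.1 (hcon v) hv
    obtain ⟨a, rfl⟩ := hsmul hv
    obtain ⟨b, rfl⟩ := hsmul hv'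
    simp [cross_self] at hvv'
  by_cases hn : (restrictToLine x w ∘ grad F) ⨯₃
      (Polynomial.derivative ∘ restrictToLine x w ∘ grad F) = 0
  · exact .inr (exists_isRulingField_of_cross_derivative_eq_zero hF hw hh htransversal hn)
  · exact .inl (exists_ruledForm_of_cross_derivative_ne_zero hF hw hh htransversal hn)

theorem IsLine.exists_restrictToLine_eq_zero [Infinite k] {F : MvPolynomial (Fin 3) k}
    {L : Set (Fin 3 → k)} (hL : IsLine L) (hLF : ∀ y ∈ L, eval y F = 0) {x : Fin 3 → k}
    (hx : x ∈ L) : ∃ v, v ≠ 0 ∧ restrictToLine x v F = 0 := by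
  obtain ⟨c, v, hv, rfl⟩ := hL
  obtain ⟨τ, rfl⟩ := hx
  refine ⟨v, hv, restrictToLine_add_smul_self_eq_zero (Polynomial.funext fun τ => ?_) τ⟩
  rw [eval_restrictToLine, Polynomial.eval_zero]
  exact hLF _ ⟨τ, rfl⟩

theorem IsRationalRuledSurface.exists_ruledForm [IsAlgClosed k] [CharZero k]
    {S : Set (Fin 3 → k)} (hS : IsRationalRuledSurface S) :
    ∃ D : RuledForm k, Parametrizes D.toMap S ∧ ∃ i, D.p i ≠ 0 := by
  obtain ⟨F, hF, rfl⟩ := hS.surface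
  obtain ⟨P, hP⟩ := hS.rational
  have hruled (x : Fin 3 → k) (hx : eval x F = 0) : ∃ v, v ≠ 0 ∧ restrictToLine x v F = 0 := by
    obtain ⟨L, hL, hxL, hLS⟩ := hS.ruled x hx
    exact hL.exists_restrictToLine_eq_zero hLS hxL
  obtain ⟨V, hV⟩ | ⟨g, hg, hlines⟩ := exists_isRulingField_or_two_lines hF hruled
  · exact hV.exists_ruledForm hF hP
  · obtain hD | ⟨V, hV⟩ := exists_ruledForm_or_isRulingField_of_two_lines hF hg hlines
    · exact hD
    · exact hV.exists_ruledForm hF hP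

end TransversalLines

section Polynomials

open Polynomial

variable {k : Type*} [Field k]

theorem aeval_reflect {K : Type*} [Field K] [Algebra k K] {N : ℕ} {f : k[X]}
    (hf : f.natDegree ≤ N) {x : K} (hx : x ≠ 0) :
    aeval x (f.reflect N) = x ^ N * aeval x⁻¹ f := by
  let : Invertible x⁻¹ := invertibleOfNonzero (inv_ne_zero hx)
  have h := eval₂_reflect_mul_pow (algebraMap k K) x⁻¹ N f hf
  rw [invOf_eq_inv, inv_inv] at h
  rw [aeval_def, aeval_def, ← h, mul_comm, mul_assoc, ← mul_pow, inv_mul_cancel₀ hx, one_pow,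
    mul_one]

theorem eval_reflect {N : ℕ} {f : k[X]} (hf : f.natDegree ≤ N) {x : k} (hx : x ≠ 0) :
    (f.reflect N).eval x = x ^ N * f.eval x⁻¹ := by
  simpa only [coe_aeval_eq_eval] using aeval_reflect hf hx

theorem eval_zero_reflect (N : ℕ) (f : k[X]) : (f.reflect N).eval 0 = f.coeff N := by
  rw [← coeff_zero_eq_eval_zero, coeff_reflect, revAt_le (Nat.zero_le N), Nat.sub_zero]

theorem natDegree_reflect_eq {N : ℕ} {f : k[X]} (hf : f.natDegree ≤ N) (h0 : f.eval 0 ≠ 0) :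
    (f.reflect N).natDegree = N := by
  refine le_antisymm (natDegree_reflect_le.trans (max_le le_rfl hf)) (le_natDegree_of_ne_zero ?_)
  rwa [coeff_reflect, revAt_le le_rfl, Nat.sub_self, coeff_zero_eq_eval_zero]

theorem exists_eq_mul_of_no_common_root {ι : Type*} [Finite ι] {p : ι → k[X]}
    (hp : ∃ i, p i ≠ 0) :
    ∃ (g : k[X]) (p' : ι → k[X]), g ≠ 0 ∧ (∀ i, p i = g * p' i) ∧ ∀ c, ∃ i, (p' i).eval c ≠ 0 := by
  classical
  have := Fintype.ofFinite ι
  let := UniqueFactorizationMonoid.toNormalizedGCDMonoid k[X]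
  obtain ⟨i, hi⟩ := hp
  obtain ⟨p', hp', hgcd⟩ := Finset.extract_gcd p ⟨i, Finset.mem_univ i⟩
  refine ⟨_, p', fun h => hi (Finset.gcd_eq_zero_iff.1 h i (Finset.mem_univ i)),
    fun j => hp' j (Finset.mem_univ j), fun c => ?_⟩
  by_contra! hc
  have hdvd : X - C c ∣ Finset.univ.gcd p' :=
    Finset.dvd_gcd fun j _ => dvd_iff_isRoot.2 (hc j)
  exact not_isUnit_X_sub_C c (isUnit_of_dvd_one (hgcd ▸ hdvd))

theorem exists_forall_eval_ne_zero [Infinite k] {ι : Type*} [Finite ι] (f : ι → k[X]) :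
    ∃ a, ∀ i, f i ≠ 0 → (f i).eval a ≠ 0 := by
  have hfin : (⋃ i : {i // f i ≠ 0}, {a | (f i).IsRoot a}).Finite :=
    Set.finite_iUnion fun i => Polynomial.finite_setOfPred_isRoot i.2
  obtain ⟨a, ha⟩ := hfin.infinite_compl.nonempty
  exact ⟨a, fun i hi hroot => ha (Set.mem_iUnion.2 ⟨⟨i, hi⟩, hroot⟩)⟩

end Polynomials

section Standardization

open Polynomial
open scoped IntermediateField

variable {k : Type*} [Field k]

theorem transcendental_paramS : Transcendental k (paramS k) :=
  (transcendental_algebraMap_iff (IsFractionRing.injective _ _)).2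
    (MvPolynomial.transcendental_X k 0)

theorem paramS_ne_zero : paramS k ≠ 0 :=
  fun h => transcendental_paramS (h ▸ isAlgebraic_zero)

theorem aeval_paramS_ne_zero {f : k[X]} (hf : f ≠ 0) : aeval (paramS k) f ≠ 0 :=
  (transcendental_iff.1 transcendental_paramS f).mt hf

theorem aeval_mem_adjoin_simple {K : Type*} [Field K] [Algebra k K] (x : K) (f : k[X]) :
    aeval x f ∈ k⟮x⟯ :=
  IntermediateField.algebra_adjoin_le_adjoin k _ (aeval_mem_adjoin_singleton k x)

theorem Parametrizes.subst_add_mul [Infinite k] {D : RuledForm k} {S : Set (Fin 3 → k)}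
    (h : Parametrizes D.toMap S) {σ α β : FunctionField k} (hσ : paramS k ∈ k⟮σ⟯)
    (hα : α ∈ k⟮paramS k⟯) (hβ : β ∈ k⟮paramS k⟯) (hβ0 : β ≠ 0) :
    Parametrizes (D.subst σ (α + β * paramT k)) S := by
  set τ := α + β * paramT k with hτ
  have hσle : k⟮σ⟯ ≤ IntermediateField.adjoin k {σ, τ} :=
    IntermediateField.adjoin.mono k _ _ (Set.singleton_subset_iff.2 (Set.mem_insert _ _))
  have hle : k⟮paramS k⟯ ≤ IntermediateField.adjoin k {σ, τ} :=
    (IntermediateField.adjoin_simple_le_iff.2 hσ).trans hσle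
  refine h.subst (hσle hσ) ?_
  have ht : paramT k = (τ - α) / β := by rw [hτ, add_sub_cancel_left, mul_div_cancel_left₀ _ hβ0]
  rw [ht]
  exact div_mem (sub_mem (IntermediateField.subset_adjoin k _ (by simp)) (hle hα)) (hle hβ)

namespace RuledForm

/-- The ruled form `((s^M rᵢ(1/s) + t s^N pᵢ(1/s)) / (s^M q(1/s)))`, a reparametrization of `D` by
`s ↦ 1/s` as soon as `M` and `N` bound the degrees of the polynomials concerned. -/
def reflect (D : RuledForm k) (M N : ℕ) : RuledForm k where
  r i := (D.r i).reflect M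
  p i := (D.p i).reflect N
  q := D.q.reflect M
  q_ne_zero := reflect_eq_zero_iff.not.2 D.q_ne_zero

theorem toMap_reflect {D : RuledForm k} {M N : ℕ} (hr : ∀ i, (D.r i).natDegree ≤ M)
    (hp : ∀ i, (D.p i).natDegree ≤ N) (hq : D.q.natDegree ≤ M) :
    (D.reflect M N).toMap =
      D.subst (paramS k)⁻¹ (paramS k ^ N / paramS k ^ M * paramT k) := by
  funext i
  have hs := paramS_ne_zero (k := k)
  have hM : paramS k ^ M ≠ 0 := pow_ne_zero M hs
  simp only [toMap, subst, reflect, aeval_reflect (hr i) hs, aeval_reflect (hp i) hs,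
    aeval_reflect hq hs]
  rw [eq_comm, ← mul_div_mul_left _ _ hM]
  congr 1
  field_simp

theorem parametrizes_toMap_reflect [Infinite k] {S : Set (Fin 3 → k)} {D : RuledForm k}
    (h : Parametrizes D.toMap S) {M N : ℕ} (hr : ∀ i, (D.r i).natDegree ≤ M)
    (hp : ∀ i, (D.p i).natDegree ≤ N) (hq : D.q.natDegree ≤ M) :
    Parametrizes (D.reflect M N).toMap S := by
  have hmem : paramS k ∈ k⟮paramS k⟯ := IntermediateField.mem_adjoin_simple_self k _
  have hs := paramS_ne_zero (k := k)
  rw [toMap_reflect hr hp hq, ← zero_add (_ * paramT k)]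
  refine h.subst_add_mul ?_ (zero_mem _) (div_mem (pow_mem hmem N) (pow_mem hmem M))
    (div_ne_zero (pow_ne_zero N hs) (pow_ne_zero M hs))
  simpa only [inv_inv] using inv_mem (IntermediateField.mem_adjoin_simple_self k (paramS k)⁻¹)

theorem exists_parametrizes_no_common_root [Infinite k] {S : Set (Fin 3 → k)} {D : RuledForm k}
    (h : Parametrizes D.toMap S) (hp : ∃ i, D.p i ≠ 0) :
    ∃ D' : RuledForm k, Parametrizes D'.toMap S ∧ ∀ c, ∃ i, (D'.p i).eval c ≠ 0 := by
  obtain ⟨g, p', hg, hp', hroot⟩ := exists_eq_mul_of_no_common_root hp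
  refine ⟨⟨D.r, p', D.q, D.q_ne_zero⟩, ?_, hroot⟩
  have hg' := aeval_paramS_ne_zero hg
  convert h.subst_add_mul (IntermediateField.mem_adjoin_simple_self k _) (zero_mem _)
    (inv_mem (aeval_mem_adjoin_simple (paramS k) g)) (inv_ne_zero hg') using 1
  funext i
  simp only [toMap, subst, hp', map_mul]
  field_simp
  ring

theorem exists_parametrizes_eval_zero_ne_zero [Infinite k] {S : Set (Fin 3 → k)} {D : RuledForm k}
    (h : Parametrizes D.toMap S) (hroot : ∀ c, ∃ i, (D.p i).eval c ≠ 0) :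
    ∃ D' : RuledForm k, Parametrizes D'.toMap S ∧ (∀ c, ∃ i, (D'.p i).eval c ≠ 0) ∧
      ∀ i, D'.p i ≠ 0 → (D'.p i).eval 0 ≠ 0 := by
  obtain ⟨a, ha⟩ := exists_forall_eval_ne_zero D.p
  refine ⟨⟨fun i => taylor a (D.r i), fun i => taylor a (D.p i), taylor a D.q,
    (taylor_eq_zero a D.q).not.2 D.q_ne_zero⟩, ?_, fun c => ?_, fun i hi => ?_⟩
  · have hσ : paramS k ∈ k⟮paramS k + algebraMap k (FunctionField k) a⟯ := by
      simpa only [add_sub_cancel_right] using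
        sub_mem (IntermediateField.mem_adjoin_simple_self k (paramS k + algebraMap k _ a))
          (IntermediateField.algebraMap_mem _ a)
    convert h.subst_add_mul hσ (zero_mem _) (one_mem _) one_ne_zero using 1
    funext i
    simp only [toMap, subst, zero_add, one_mul, taylor_apply, aeval_comp, map_add, aeval_X, aeval_C]
  · simpa only [taylor_eval] using hroot (c + a)
  · simpa only [taylor_eval, zero_add] using ha i ((taylor_eq_zero a _).not.1 hi)

theorem isStandardized_reflect [Infinite k] {S : Set (Fin 3 → k)} {D : RuledForm k}
    (h : Parametrizes D.toMap S) (hroot : ∀ c, ∃ i, (D.p i).eval c ≠ 0)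
    (h0 : ∀ i, D.p i ≠ 0 → (D.p i).eval 0 ≠ 0) {M N : ℕ} (hr : ∀ i, (D.r i).natDegree ≤ M)
    (hp : ∀ i, (D.p i).natDegree ≤ N) (hq : D.q.natDegree ≤ M) (hN : ∃ i, (D.p i).coeff N ≠ 0) :
    (D.reflect M N).IsStandardized S where
  parametrizes := parametrizes_toMap_reflect h hr hp hq
  degree_eq := by
    have hdeg : ∀ i, (D.reflect M N).p i ≠ 0 → ((D.reflect M N).p i).natDegree = N := fun i hi =>
      natDegree_reflect_eq (hp i) (h0 i (reflect_eq_zero_iff.not.1 hi))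
    exact fun i j hi hj => (hdeg i hi).trans (hdeg j hj).symm
  exists_ne_zero := hN.imp fun i hi => reflect_eq_zero_iff.not.2 fun h =>
    hi (by rw [show D.p i = 0 from h, coeff_zero])
  no_common_root := by
    rintro ⟨c, hc⟩
    suffices ∃ i, ((D.p i).reflect N).eval c ≠ 0 by
      obtain ⟨i, hi⟩ := this
      exact hi (hc i fun h => hi (by rw [show (D.p i).reflect N = 0 from h, eval_zero]))
    rcases eq_or_ne c 0 with rfl | hc0
    · simpa only [eval_zero_reflect] using hN
    · obtain ⟨i, hi⟩ := hroot c⁻¹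
      exact ⟨i, by rw [eval_reflect (hp i) hc0]; exact mul_ne_zero (pow_ne_zero _ hc0) hi⟩

theorem exists_isStandardized [Infinite k] {S : Set (Fin 3 → k)} {D : RuledForm k}
    (h : Parametrizes D.toMap S) (hp : ∃ i, D.p i ≠ 0) :
    ∃ D' : RuledForm k, D'.IsStandardized S := by
  obtain ⟨D₁, h₁, hroot₁⟩ := exists_parametrizes_no_common_root h hp
  obtain ⟨D₂, h₂, hroot, h0⟩ := exists_parametrizes_eval_zero_ne_zero h₁ hroot₁
  obtain ⟨i, hi⟩ := Finite.exists_max fun i => (D₂.p i).degree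
  have hpi : D₂.p i ≠ 0 := by
    intro hpi
    obtain ⟨j, hj⟩ := hroot 0
    have hj0 : D₂.p j = 0 := degree_eq_bot.1 (le_bot_iff.1 ((hi j).trans_eq (by simp [hpi])))
    exact hj (by rw [hj0, eval_zero])
  let M := (Finset.univ.sup fun i => (D₂.r i).natDegree) ⊔ D₂.q.natDegree
  have hr : ∀ j, (D₂.r j).natDegree ≤ M := fun j =>
    le_sup_of_le_left (Finset.le_sup (f := fun i => (D₂.r i).natDegree) (Finset.mem_univ j))
  exact ⟨_, isStandardized_reflect h₂ hroot h0 hr (fun j => natDegree_le_natDegree (hi j))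
    le_sup_right ⟨i, leadingCoeff_ne_zero.2 hpi⟩⟩

theorem IsStandardized.exists_natDegree_q_lt [Infinite k] {S : Set (Fin 3 → k)} {D : RuledForm k}
    (hD : D.IsStandardized S) {a b : k} (hab : D.IsAffineBasePoint a b) :
    ∃ D' : RuledForm k, D'.IsStandardized S ∧ D'.q.natDegree < D.q.natDegree := by
  obtain ⟨q', hq'⟩ := dvd_iff_isRoot.2 hab.1
  have hdvd : ∀ i, X - C a ∣ D.r i + C b * D.p i := fun i =>
    dvd_iff_isRoot.2 (by simpa only [IsRoot, eval_add, eval_mul, eval_C] using hab.2 i)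
  choose r' hr' using hdvd
  have hq0 : q' ≠ 0 := right_ne_zero_of_mul (hq' ▸ D.q_ne_zero)
  refine ⟨⟨r', D.p, q', hq0⟩,
    ⟨?_, hD.degree_eq, hD.exists_ne_zero, hD.no_common_root⟩, ?_⟩
  · have hsa := aeval_paramS_ne_zero (X_sub_C_ne_zero a)
    have hmem := aeval_mem_adjoin_simple (paramS k) (X - C a)
    convert hD.parametrizes.subst_add_mul (IntermediateField.mem_adjoin_simple_self k _)
      (algebraMap_mem _ b) hmem hsa using 1
    funext i
    have hri : aeval (paramS k) (D.r i) = aeval (paramS k) (X - C a) * aeval (paramS k) (r' i) -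
        algebraMap k (FunctionField k) b * aeval (paramS k) (D.p i) := by
      rw [← map_mul, ← hr' i, map_add, map_mul, aeval_C, add_sub_cancel_right]
    simp only [toMap, subst, hri, hq', map_mul (aeval (paramS k))]
    rw [← mul_div_mul_left _ _ hsa]
    ring
  · rw [hq', natDegree_mul (X_sub_C_ne_zero a) hq0, natDegree_X_sub_C]
    exact Nat.lt_add_of_pos_left one_pos

theorem IsStandardized.exists_no_affineBasePoint [Infinite k] {S : Set (Fin 3 → k)}
    {D : RuledForm k} (hD : D.IsStandardized S) :
    ∃ D' : RuledForm k, D'.IsStandardized S ∧ ∀ a b, ¬ D'.IsAffineBasePoint a b := by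
  induction hn : D.q.natDegree using Nat.strong_induction_on generalizing D with
  | _ n ih =>
    by_cases hb : ∃ a b, D.IsAffineBasePoint a b
    · obtain ⟨a, b, hab⟩ := hb
      obtain ⟨D', hD', hlt⟩ := hD.exists_natDegree_q_lt hab
      exact ih _ (hn ▸ hlt) hD' rfl
    · push Not at hb
      exact ⟨D, hD, hb⟩

end RuledForm

theorem IsRationalRuledSurface.exists_isStandardized [IsAlgClosed k] [CharZero k]
    {S : Set (Fin 3 → k)} (hS : IsRationalRuledSurface S) :
    ∃ D : RuledForm k, D.IsStandardized S ∧ ∀ a b, ¬ D.IsAffineBasePoint a b := by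
  obtain ⟨D, hD, hp⟩ := hS.exists_ruledForm
  obtain ⟨D', hD'⟩ := RuledForm.exists_isStandardized hD hp
  exact hD'.exists_no_affineBasePoint

end Standardization

section Elimination

open Polynomial

theorem eval₂_resultant_eq_zero {A B : Type*} [CommRing A] [CommRing B] (φ : A →+* B)
    {f g : A[X]} {m n : ℕ} (hf : f.natDegree ≤ m) (hg : g.natDegree ≤ n) (hmn : m ≠ 0 ∨ n ≠ 0)
    {b : B} (hfb : f.eval₂ φ b = 0) (hgb : g.eval₂ φ b = 0) : φ (resultant f g m n) = 0 := by
  obtain ⟨p, q, -, -, hpq⟩ := exists_mul_add_mul_eq_C_resultant f g hf hg hmn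
  have h := congrArg (eval₂ φ b) hpq
  rwa [eval₂_add, eval₂_mul, eval₂_mul, hfb, hgb, zero_mul, zero_mul, add_zero, eval₂_C,
    eq_comm] at h

variable {k : Type*} [Field k]

theorem exists_common_root_of_resultant_eq_zero [IsAlgClosed k] {f g : k[X]} {n : ℕ} (hf : f ≠ 0)
    (hg : g.natDegree ≤ n) (h : resultant f g f.natDegree n = 0) :
    ∃ s, f.eval s = 0 ∧ g.eval s = 0 := by
  rw [resultant_eq_prod_eval f g n hg (IsAlgClosed.splits f)] at h
  have hprod := (mul_eq_zero.1 h).resolve_left (pow_ne_zero n (leadingCoeff_ne_zero.2 hf))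
  obtain ⟨s, hs, hgs⟩ := Multiset.mem_map.1 (Multiset.prod_eq_zero_iff.1 hprod)
  exact ⟨s, isRoot_of_mem_roots hs, hgs⟩

theorem exists_forall_dotProduct_ne_zero [Infinite k] {ι κ : Type*} [Fintype ι] [Finite κ]
    {v : κ → ι → k} (hv : ∀ a, v a ≠ 0) : ∃ c, ∀ a, v a ⬝ᵥ c ≠ 0 := by
  classical
  refine Module.Dual.exists_forall_ne_zero_of_forall_exists (fun a => dotProductEquiv k ι (v a))
    fun a => ?_
  obtain ⟨i, hi⟩ := Function.ne_iff.1 (hv a)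
  exact ⟨Pi.single i 1, by simpa using hi⟩

theorem exists_common_root_or_coeff_eq_zero [IsAlgClosed k] {ι A K : Type*} [Finite ι] [CommRing A]
    [Algebra k A] [CommRing K] (φ : A →+* K) (ε : A →ₐ[k] k)
    (hker : ∀ a, φ a = 0 → ε a = 0) {E : ι → A[X]} {N : ℕ} (hE : ∀ i, (E i).natDegree ≤ N)
    {b : K} (hb : ∀ i, (E i).eval₂ φ b = 0) :
    (∃ s, ∀ i, (E i).eval₂ (ε : A →+* k) s = 0) ∨ ∀ i, ε ((E i).coeff N) = 0 := by
  have := Fintype.ofFinite ι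
  by_contra! hcon
  obtain ⟨hroot, i₀, hi₀⟩ := hcon
  set f := (E i₀).map (ε : A →+* k) with hf
  have hcoeff : f.coeff N ≠ 0 := by rwa [hf, coeff_map]
  have hfN : f.natDegree = N :=
    le_antisymm (natDegree_map_le.trans (hE i₀)) (le_natDegree_of_ne_zero hcoeff)
  have hv : ∀ s : {s // f.IsRoot s}, (fun i => (E i).eval₂ (ε : A →+* k) s) ≠ 0 :=
    fun s => Function.ne_iff.2 (hroot s)
  have : Finite {s // f.IsRoot s} :=
    finite_setOfPred_isRoot fun h => hcoeff (by rw [h, coeff_zero])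
  obtain ⟨c, hc⟩ := exists_forall_dotProduct_ne_zero hv
  let g := ∑ i, C (algebraMap k A (c i)) * E i
  have hg : g.natDegree ≤ N + 1 := natDegree_sum_le_of_forall_le _ _ fun i _ =>
    (natDegree_C_mul_le _ _).trans ((hE i).trans N.le_succ)
  have hres := hker _ <| eval₂_resultant_eq_zero φ (hE i₀) hg (Or.inr N.succ_ne_zero) (hb i₀)
    (by simp [g, eval₂_finsetSum, hb])
  obtain ⟨s, hfs, hgs⟩ := exists_common_root_of_resultant_eq_zero (f := f)
    (g := g.map (ε : A →+* k)) (fun h => hcoeff (by rw [h, coeff_zero]))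
    (natDegree_map_le.trans hg) (by rw [hfN, hf, resultant_map_map]; exact hres)
  refine hc ⟨s, hfs⟩ ?_
  simpa [g, eval_map, eval₂_finsetSum, dotProduct, mul_comm] using hgs

end Elimination

section LineAtInfinity

open Polynomial

variable {k : Type*} [Field k]

theorem Parametrizes.eval_eq_zero [Infinite k] {P : Fin 3 → FunctionField k} {S : Set (Fin 3 → k)}
    (h : Parametrizes P S) {x : Fin 3 → k} (hx : x ∈ S) {G : MvPolynomial (Fin 3) k}
    (hG : MvPolynomial.aeval P G = 0) : MvPolynomial.aeval x G = 0 := by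
  rw [← parametrizes_iff_zeroLocus_ker.1 h] at hx
  exact hx G hG

namespace RuledForm

/-- The polynomials `rᵢ pⱼ - rⱼ pᵢ`. Together with the `q pᵢ` they are the Plücker coordinates
of the lines of a ruled form. -/
def moment (D : RuledForm k) (i j : Fin 3) : k[X] :=
  D.r i * D.p j - D.r j * D.p i

/-- The equations `xᵢ q pⱼ - xⱼ q pᵢ = rᵢ pⱼ - rⱼ pᵢ` expressing that the point `x` lies on the
line of parameter `s`, as polynomials in `s` over the coordinate ring of the space. -/
def incidence (D : RuledForm k) (ij : Fin 3 × Fin 3) : (MvPolynomial (Fin 3) k)[X] :=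
  C (MvPolynomial.X ij.1) * (D.q * D.p ij.2).map MvPolynomial.C -
    C (MvPolynomial.X ij.2) * (D.q * D.p ij.1).map MvPolynomial.C -
    (D.moment ij.1 ij.2).map MvPolynomial.C

/-- The points whose incidence equations have no term of degree `N`. If `N` is the degree of the
system of equations, these are the points of the line of parameter `s = ∞`. -/
def lineAtInfinity (D : RuledForm k) (N : ℕ) : Set (Fin 3 → k) :=
  {x | ∀ i j, x i * (D.q * D.p j).coeff N - x j * (D.q * D.p i).coeff N = (D.moment i j).coeff N}

variable {D : RuledForm k} {S : Set (Fin 3 → k)}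

theorem eval₂_incidence {B : Type*} [CommRing B] [Algebra k B]
    (φ : MvPolynomial (Fin 3) k →ₐ[k] B) (b : B) (ij : Fin 3 × Fin 3) :
    (D.incidence ij).eval₂ (φ : MvPolynomial (Fin 3) k →+* B) b =
      φ (MvPolynomial.X ij.1) * aeval b (D.q * D.p ij.2) -
        φ (MvPolynomial.X ij.2) * aeval b (D.q * D.p ij.1) - aeval b (D.moment ij.1 ij.2) := by
  have hφ : (φ : MvPolynomial (Fin 3) k →+* B).comp MvPolynomial.C = algebraMap k B :=
    φ.comp_algebraMap
  simp only [incidence, eval₂_sub, eval₂_mul, eval₂_C, eval₂_map, hφ, ← aeval_def, RingHom.coe_coe,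
    map_mul]

theorem aeval_coeff_incidence (x : Fin 3 → k) (ij : Fin 3 × Fin 3) (N : ℕ) :
    MvPolynomial.aeval x ((D.incidence ij).coeff N) =
      x ij.1 * (D.q * D.p ij.2).coeff N - x ij.2 * (D.q * D.p ij.1).coeff N -
        (D.moment ij.1 ij.2).coeff N := by
  simp only [incidence, coeff_sub, coeff_C_mul, coeff_map, map_sub, map_mul, MvPolynomial.aeval_X,
    MvPolynomial.aeval_C, Algebra.algebraMap_self_apply]

theorem natDegree_incidence_le {N : ℕ} (hq : ∀ i, (D.q * D.p i).natDegree ≤ N)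
    (hm : ∀ i j, (D.moment i j).natDegree ≤ N) (ij : Fin 3 × Fin 3) :
    (D.incidence ij).natDegree ≤ N := by
  have hterm : ∀ i j, (C (MvPolynomial.X i) * (D.q * D.p j).map MvPolynomial.C :
      (MvPolynomial (Fin 3) k)[X]).natDegree ≤ N := fun i j =>
    (natDegree_C_mul_le _ _).trans (natDegree_map_le.trans (hq j))
  exact natDegree_sub_le_of_le (natDegree_sub_le_of_le (hterm _ _) (hterm _ _))
    (natDegree_map_le.trans (hm _ _)) |>.trans (by simp)

theorem eval₂_incidence_toMap (ij : Fin 3 × Fin 3) :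
    (D.incidence ij).eval₂ (MvPolynomial.aeval (R := k) D.toMap :
      MvPolynomial (Fin 3) k →+* FunctionField k) (paramS k) = 0 := by
  have hq := aeval_paramS_ne_zero D.q_ne_zero
  rw [eval₂_incidence]
  simp only [MvPolynomial.aeval_X, toMap, subst, moment, map_sub, map_mul]
  field_simp
  ring

theorem mem_image_toMap_of_incidence (hp : ∀ c, ∃ i, (D.p i).eval c ≠ 0)
    (hb : ∀ a b, ¬ D.IsAffineBasePoint a b) {x : Fin 3 → k} {s : k}
    (h : ∀ ij, (D.incidence ij).eval₂ (MvPolynomial.aeval (R := k) x :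
      MvPolynomial (Fin 3) k →+* k) s = 0) : x ∈ image D.toMap := by
  obtain ⟨j, hj⟩ := hp s
  let t := (D.q.eval s * x j - (D.r j).eval s) / (D.p j).eval s
  have ht : ∀ i, D.q.eval s * x i = (D.r i).eval s + t * (D.p i).eval s := by
    intro i
    have hij := h (i, j)
    rw [eval₂_incidence] at hij
    simp only [MvPolynomial.aeval_X, coe_aeval_eq_eval, moment, eval_sub, eval_mul] at hij
    simp only [t]
    field_simp
    linear_combination hij
  have hq : D.q.eval s ≠ 0 := fun hq => hb s t ⟨hq, fun i => by rw [← ht i, hq, zero_mul]⟩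
  have hx : x = D.pt s t := funext fun i => by rw [pt, ← ht i, mul_div_cancel_left₀ _ hq]
  exact ⟨_, hx ▸ D.hasValueAt_toMap hq⟩

theorem IsStandardized.exists_eval_ne_zero (hD : D.IsStandardized S) (c : k) :
    ∃ i, (D.p i).eval c ≠ 0 := by
  by_contra! h
  exact hD.no_common_root ⟨c, fun i _ => h i⟩

theorem IsStandardized.diff_image_subset_lineAtInfinity [IsAlgClosed k] (hD : D.IsStandardized S)
    (hb : ∀ a b, ¬ D.IsAffineBasePoint a b) {N : ℕ} (hq : ∀ i, (D.q * D.p i).natDegree ≤ N)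
    (hm : ∀ i j, (D.moment i j).natDegree ≤ N) :
    S \ image D.toMap ⊆ D.lineAtInfinity N := by
  rintro x ⟨hxS, hx⟩ i j
  rcases exists_common_root_or_coeff_eq_zero _ (MvPolynomial.aeval x)
    (fun G hG => hD.parametrizes.eval_eq_zero hxS hG) (natDegree_incidence_le hq hm)
    eval₂_incidence_toMap with ⟨s, hs⟩ | h
  · exact absurd (mem_image_toMap_of_incidence hD.exists_eval_ne_zero hb hs) hx
  · exact sub_eq_zero.1 ((aeval_coeff_incidence x (i, j) N).symm.trans (h (i, j)))

theorem IsStandardized.image_eq_of_lt_natDegree_moment [IsAlgClosed k] (hD : D.IsStandardized S)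
    (hb : ∀ a b, ¬ D.IsAffineBasePoint a b) {i₀ j₀ : Fin 3}
    (h : ∀ i, (D.q * D.p i).natDegree < (D.moment i₀ j₀).natDegree) : image D.toMap = S := by
  obtain ⟨⟨i, j⟩, hij⟩ := Finite.exists_max fun ij : Fin 3 × Fin 3 => (D.moment ij.1 ij.2).natDegree
  set N := (D.moment i j).natDegree with hN
  have hq : ∀ l, (D.q * D.p l).natDegree < N := fun l => (h l).trans_le (hij (i₀, j₀))
  refine Set.Subset.antisymm hD.parametrizes.image_subset fun x hxS => ?_
  by_contra hx
  have hx' := hD.diff_image_subset_lineAtInfinity hb (fun l => (hq l).le)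
    (fun l m => hij (l, m)) ⟨hxS, hx⟩ i j
  rw [coeff_eq_zero_of_natDegree_lt (hq i), coeff_eq_zero_of_natDegree_lt (hq j), mul_zero,
    mul_zero, sub_zero, hN, coeff_natDegree, eq_comm, leadingCoeff_eq_zero] at hx'
  exact (Nat.zero_le _).not_gt ((hq i).trans_eq (by rw [hN, hx', natDegree_zero]))

/-- The ruled form of `𝒬(s,t) = 𝒫(s, (q(s) t - rⱼ(s)) / pⱼ(s))`. -/
def ruledFormQ (D : RuledForm k) {j : Fin 3} (hj : D.p j ≠ 0) : RuledForm k where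
  r i := D.moment i j
  p i := D.q * D.p i
  q := D.q * D.p j
  q_ne_zero := mul_ne_zero D.q_ne_zero hj

theorem subst_ruledFormQ {j : Fin 3} (hj : D.p j ≠ 0) {σ : FunctionField k}
    (hσ : Transcendental k σ) (τ : FunctionField k) :
    (D.ruledFormQ hj).subst σ τ = D.substQ j σ τ := by
  have hq := (transcendental_iff.1 hσ D.q).mt D.q_ne_zero
  have hpj := (transcendental_iff.1 hσ (D.p j)).mt hj
  funext i
  simp only [substQ, subst, ruledFormQ, moment, map_sub, map_mul]
  field_simp
  ring

theorem mapH_eq_toMap_reflect {j : Fin 3} (hj : D.p j ≠ 0) {N : ℕ}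
    (hq : ∀ i, (D.q * D.p i).natDegree ≤ N) (hm : ∀ i j, (D.moment i j).natDegree ≤ N) :
    D.mapH j = ((D.ruledFormQ hj).reflect N N).toMap := by
  rw [toMap_reflect (D := D.ruledFormQ hj) (fun i => hm i j) hq (hq j),
    div_self (pow_ne_zero N paramS_ne_zero), one_mul,
    subst_ruledFormQ hj (IsAlgebraic.inv_iff.not.2 transcendental_paramS), mapH, one_div]

theorem parametrizes_mapH [Infinite k] (h : Parametrizes D.toMap S) {j : Fin 3} (hj : D.p j ≠ 0)
    {N : ℕ} (hq : ∀ i, (D.q * D.p i).natDegree ≤ N) (hm : ∀ i j, (D.moment i j).natDegree ≤ N) :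
    Parametrizes (D.mapH j) S := by
  rw [mapH_eq_toMap_reflect hj hq hm]
  refine parametrizes_toMap_reflect (D := D.ruledFormQ hj) ?_ (fun i => hm i j) hq (hq j)
  have hmem := fun f : k[X] => aeval_mem_adjoin_simple (paramS k) f
  rw [toMap, subst_ruledFormQ hj transcendental_paramS, substQ, sub_div, sub_eq_neg_add,
    mul_div_right_comm]
  exact h.subst_add_mul (IntermediateField.mem_adjoin_simple_self k _)
    (neg_mem (div_mem (hmem _) (hmem _))) (div_mem (hmem _) (hmem _))
    (div_ne_zero (aeval_paramS_ne_zero D.q_ne_zero) (aeval_paramS_ne_zero hj))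

theorem coeff_moment_relation {N : ℕ} (hq : ∀ i, (D.q * D.p i).natDegree ≤ N)
    (hm : ∀ i j, (D.moment i j).natDegree ≤ N) (i j l : Fin 3) :
    (D.q * D.p l).coeff N * (D.moment i j).coeff N =
      (D.q * D.p j).coeff N * (D.moment i l).coeff N -
        (D.q * D.p i).coeff N * (D.moment j l).coeff N := by
  rw [← coeff_mul_add_eq_of_natDegree_le (hq l) (hm i j),
    ← coeff_mul_add_eq_of_natDegree_le (hq j) (hm i l),
    ← coeff_mul_add_eq_of_natDegree_le (hq i) (hm j l), ← coeff_sub]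
  congr 1
  simp only [moment]
  ring

theorem lineAtInfinity_eq_range_pt {j : Fin 3} (hj : D.p j ≠ 0) {N : ℕ}
    (hq : ∀ i, (D.q * D.p i).natDegree ≤ N) (hm : ∀ i j, (D.moment i j).natDegree ≤ N)
    (hlead : (D.q * D.p j).coeff N ≠ 0) :
    D.lineAtInfinity N = Set.range (((D.ruledFormQ hj).reflect N N).pt 0) := by
  ext x
  constructor
  · intro hx
    refine ⟨x j, funext fun i => ?_⟩
    simp only [pt, reflect, ruledFormQ, eval_zero_reflect]
    rw [div_eq_iff hlead]
    linear_combination -hx i j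
  · rintro ⟨t, rfl⟩ i m
    have hrel := coeff_moment_relation hq hm i m j
    simp only [pt, reflect, ruledFormQ, eval_zero_reflect]
    field_simp
    linear_combination -hrel

theorem exists_hasValueAt_mapH {j : Fin 3} (hj : D.p j ≠ 0) {N : ℕ}
    (hq : ∀ i, (D.q * D.p i).natDegree ≤ N) (hm : ∀ i j, (D.moment i j).natDegree ≤ N)
    (hlead : (D.q * D.p j).coeff N ≠ 0) :
    ∃ c v : Fin 3 → k, v ≠ 0 ∧ D.lineAtInfinity N = Set.range (fun τ : k => c + τ • v) ∧
      ∀ τ : k, HasValueAt (D.mapH j) ![0, τ] (c + τ • v) := by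
  have hlead' : ((D.ruledFormQ hj).reflect N N).q.eval 0 ≠ 0 := by
    simpa only [reflect, ruledFormQ, eval_zero_reflect] using hlead
  obtain ⟨c, v, hv, hpt⟩ := ((D.ruledFormQ hj).reflect N N).exists_pt_eq_add_smul hlead'
    ⟨j, hlead'⟩
  refine ⟨c, v, hv, ?_, fun τ => ?_⟩
  · rw [lineAtInfinity_eq_range_pt hj hq hm hlead, funext hpt]
  · rw [← hpt, mapH_eq_toMap_reflect hj hq hm]
    exact hasValueAt_toMap _ hlead'

theorem IsStandardized.natDegree_q_mul_p (hD : D.IsStandardized S) {i j : Fin 3} (hi : D.p i ≠ 0)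
    (hj : D.p j ≠ 0) : (D.q * D.p i).natDegree = (D.q * D.p j).natDegree := by
  rw [natDegree_mul D.q_ne_zero hi, natDegree_mul D.q_ne_zero hj, hD.degree_eq i j hi hj]

theorem IsStandardized.covers [IsAlgClosed k] (hD : D.IsStandardized S)
    (hb : ∀ a b, ¬ D.IsAffineBasePoint a b) :
    image D.toMap = S ∨
      ∃ L : Set (Fin 3 → k), IsLine L ∧ L ⊆ S ∧ S \ image D.toMap ⊆ L ∧
        ∀ j : Fin 3, D.p j ≠ 0 →
          IsInRuledForm (D.mapH j) ∧ Parametrizes (D.mapH j) S ∧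
          (∃ c v : Fin 3 → k, v ≠ 0 ∧ L = Set.range (fun τ : k => c + τ • v) ∧
            ∀ τ : k, HasValueAt (D.mapH j) ![0, τ] (c + τ • v)) ∧
          image D.toMap ∪ image (D.mapH j) = S := by
  obtain ⟨j₀, hj₀⟩ := hD.exists_ne_zero
  set N := (D.q * D.p j₀).natDegree with hN
  have hq : ∀ i, (D.q * D.p i).natDegree ≤ N := fun i => by
    by_cases hi : D.p i = 0
    · simp [hi]
    · exact (hD.natDegree_q_mul_p hi hj₀).le
  by_cases hm : ∀ i j, (D.moment i j).natDegree ≤ N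
  swap
  · push Not at hm
    obtain ⟨i, j, hij⟩ := hm
    exact Or.inl (hD.image_eq_of_lt_natDegree_moment hb fun l => (hq l).trans_lt hij)
  have hline := fun j (hj : D.p j ≠ 0) => exists_hasValueAt_mapH hj hq hm (by
    rw [hN, ← hD.natDegree_q_mul_p hj hj₀]
    exact leadingCoeff_ne_zero.2 (mul_ne_zero D.q_ne_zero hj))
  have hparam := fun j (hj : D.p j ≠ 0) => parametrizes_mapH hD.parametrizes hj hq hm
  have hsub : ∀ j, D.p j ≠ 0 → D.lineAtInfinity N ⊆ image (D.mapH j) := by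
    intro j hj
    obtain ⟨c, v, -, hL, hval⟩ := hline j hj
    exact hL ▸ Set.range_subset_iff.2 fun τ => ⟨_, hval τ⟩
  have hdiff := hD.diff_image_subset_lineAtInfinity hb hq hm
  obtain ⟨c, v, hv, hL, -⟩ := hline j₀ hj₀
  refine Or.inr ⟨D.lineAtInfinity N, ⟨c, v, hv, hL⟩,
    (hsub j₀ hj₀).trans (hparam j₀ hj₀).image_subset, hdiff, fun j hj =>
      ⟨⟨_, mapH_eq_toMap_reflect hj hq hm⟩, hparam j hj, hline j hj, ?_⟩⟩
  exact Set.Subset.antisymm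
    (Set.union_subset hD.parametrizes.image_subset (hparam j hj).image_subset)
    (Set.sdiff_subset_iff.1 (hdiff.trans (hsub j hj)))

end RuledForm

end LineAtInfinity

end RuledSurface

end

theorem mainTheorem1 {k : Type*} [Field k] [IsAlgClosed k] [CharZero k]
    (S : Set (Fin 3 → k)) (hS : RuledSurface.IsRationalRuledSurface S) :
    (∃ D : RuledSurface.RuledForm k,
      D.IsStandardized S ∧ ∀ a b : k, ¬ D.IsAffineBasePoint a b) ∧
    ∀ D : RuledSurface.RuledForm k, D.IsStandardized S →
      (∀ a b : k, ¬ D.IsAffineBasePoint a b) →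
      RuledSurface.image D.toMap = S ∨
      ∃ L : Set (Fin 3 → k), RuledSurface.IsLine L ∧ L ⊆ S ∧
        S \ RuledSurface.image D.toMap ⊆ L ∧
        ∀ j : Fin 3, D.p j ≠ 0 →
          RuledSurface.IsInRuledForm (D.mapH j) ∧
          RuledSurface.Parametrizes (D.mapH j) S ∧
          (∃ c v : Fin 3 → k, v ≠ 0 ∧ L = Set.range (fun τ : k => c + τ • v) ∧
            ∀ τ : k, RuledSurface.HasValueAt (D.mapH j) ![0, τ] (c + τ • v)) ∧
          RuledSurface.image D.toMap ∪ RuledSurface.image (D.mapH j) = S :=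
  ⟨hS.exists_isStandardized, fun _ hD hb => hD.covers hb⟩
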